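/- Let $\Omega\subset\mathbb{R}^n$ be an open bounded Lipschitz domain with volume measure ${\rm d}x$, surface measure ${\rm d}S$ on $\partial\Omega$, and outward unit normal $\hat n$ (defined a.e. on $\partial\Omega$), and let $p\in(1,\infty)$. Let $f,a,c:\overline\Omega\times\mathbb{R}^m\times\mathbb{R}^{m\times n}\to\mathbb{R}$ be continuous on $\Omega\times\mathbb{R}^m\times\mathbb{R}^{m\times n}$, let $g,b,d:\partial\Omega\times\mathbb{R}^m\to\mathbb{R}$ be continuous, and suppose that $|f|,|a|\le C(1+|y|^p+|z|^p)$ for a.e. $x\in\Omega$ and all $y,z$, and $|g|,|b|\le C(1+|y|^p)$ for a.e. $x\in\partial\Omega$ and all $y$, for some constant $C$. Call $u\in W^{1,p}(\Omega;\mathbb{R}^m)$ admissible if $$\int_\Omega a(x,u,\nabla u)\,{\rm d}x+\int_{\partial\Omega}b(x,u)\,{\rm d}S=0,\qquad c(x,u,\nabla u)=0\ \text{a.e. on }\Omega,\qquad d(x,u)=0\ \text{a.e. on }\partial\Omega,$$ where $u$ on $\partial\Omega$ means the trace of $u$, and put $$\Psi(u)=\int_\Omega f(x,u,\nabla u)\,{\rm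 d}x+\int_{\partial\Omega}g(x,u)\,{\rm d}S,\qquad \mathcal{F}^*=\inf\{\Psi(u):u\text{ admissible}\}.$$ Let $\Phi_p$ be the set of $\phi\in C^1(\overline\Omega\times\mathbb{R}^m;\mathbb{R}^n)$ for which, with some constant $C$, $\sum_{i,j}|\partial_{y_j}\phi_i|\le C(1+|y|^{p-1})$ and $\sum_i|\phi_i|+\sum_i|\partial_{x_i}\phi_i|\le C(1+|y|^p)$ on $\overline\Omega\times\mathbb{R}^m$, and put $\mathcal{D}\phi(x,y,z)=\sum_i\partial_{x_i}\phi_i(x,y)+\sum_{i,j}\partial_{y_j}\phi_i(x,y)z_{ji}$. For $\phi\in\Phi_p$, $\eta\in\mathbb{R}$, $h\in C(\overline\Omega)$, $\ell\in C(\partial\Omega)$ put $$F^{\phi,\eta,h}(x,y,z)=f+\mathcal{D}\phi-\eta\,a-h(x),\qquad G^{\phi,\eta,\ell}(x,y)=g-\phi\cdot\hat n(x)-\eta\,b-\ell(x),$$ let $\mathbb{B}$ be the set of all such $(\phi,\eta,h,\ell)$ with $F^{\phi,\eta,h}\ge0$ on $\{(x,y,z)\in\overline\Omega\times\mathbb{R}^m\times\mathbb{R}^{m\times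 n}:c(x,y,z)=0\}$ and $G^{\phi,\eta,\ell}\ge0$ at every point of $\{(x,y)\in\partial\Omega\times\mathbb{R}^m:d(x,y)=0\}$ for which $\hat n(x)$ exists, and let $$\mathcal{L}_{\rm pdr}=\sup_{(\phi,\eta,h,\ell)\in\mathbb{B}}\Big\{\int_\Omega h\,{\rm d}x+\int_{\partial\Omega}\ell\,{\rm d}S\Big\}.$$ Suppose that $\mathcal{F}^*=\mathcal{L}_{\rm pdr}$. Given $\varepsilon>0$, let $u$ be admissible with $\Psi(u)\le\mathcal{F}^*+\varepsilon$, and let $(\phi,\eta,h,\ell)\in\mathbb{B}$ satisfy $\mathcal{F}^*-\varepsilon\le\int_\Omega h\,{\rm d}x+\int_{\partial\Omega}\ell\,{\rm d}S$. Then, for every $\delta>0$, the volume measure $\lambda_\delta$ of $\{x\in\Omega:F^{\phi,\eta,h}(x,u(x),\nabla u(x))\ge\delta\}$ and the surface measure $\sigma_\delta$ of $\{x\in\partial\Omega:G^{\phi,\eta,\ell}(x,u(x))\ge\delta\}$ satisfy $$\lambda_\delta+\sigma_\delta\le\frac{2\varepsilon}{\delta}.$$ -/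

import Mathlib

open MeasureTheory Filter Topology Set
open scoped ContDiff ENNReal RealInnerProductSpace

/-- The Euclidean space `ℝᵏ`. -/
abbrev Euc (k : ℕ) : Type := EuclideanSpace ℝ (Fin k)

/-- Gradients of maps `ℝⁿ → ℝᵐ`.  The `m × n` matrix `z` is identified with the linear map it
represents: the entry `z_{ji}` is `(z eᵢ)_j`, see `matEntry`. -/
abbrev Grad (n m : ℕ) : Type := Euc n →L[ℝ] Euc m

/-- The entry `z_{ji}` of the matrix of `z`. -/
noncomputable def matEntry {n m : ℕ} (z : Grad n m) (j : Fin m) (i : Fin n) : ℝ :=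
  z (EuclideanSpace.single i 1) j

/-- Bounded open Lipschitz sets: near every boundary point `x₀`, there are a direction `e` and a
Lipschitz function `γ` of the variables orthogonal to `e` (i.e. constant along `e`), such that
`Ω` is the region above the graph of `γ` in direction `e`. -/
structure IsLipschitzDomain {n : ℕ} (Ω : Set (Euc n)) : Prop where
  isOpen : IsOpen Ω
  isBounded : Bornology.IsBounded Ω
  graph : ∀ x₀ ∈ frontier Ω, ∃ (e : Euc n) (γ : Euc n → ℝ),
    ‖e‖ = 1 ∧ (∃ K, LipschitzWith K γ) ∧ (∀ (x : Euc n) (t : ℝ), γ (x + t • e) = γ x) ∧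
      ∀ᶠ x in 𝓝 x₀, (x ∈ Ω ↔ γ x < ⟪x, e⟫)

/-- The surface measure on `∂Ω`: the restriction to `∂Ω` of the `(n-1)`-dimensional Hausdorff
measure, normalized so that it agrees with Lebesgue measure on `(n-1)`-dimensional planes. -/
noncomputable def surfaceMeasure {n : ℕ} (Ω : Set (Euc n)) : Measure (Euc n) :=
  (Measure.euclideanHausdorffMeasure (n - 1) : Measure (Euc n)).restrict (frontier Ω)

/-- `ν` is the outward unit normal to `Ω` at `x`: near `x`, up to cones of arbitrarily small
aperture around the tangent plane `ν^⊥`, the set `Ω` is the half-space opposite to `ν`.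
There is at most one such `ν` at a boundary point. -/
def IsOutwardUnitNormal {n : ℕ} (Ω : Set (Euc n)) (x ν : Euc n) : Prop :=
  ‖ν‖ = 1 ∧ ∀ κ : ℝ, 0 < κ → ∀ᶠ y in 𝓝 x,
    (⟪y - x, ν⟫ < -(κ * ‖y - x‖) → y ∈ Ω) ∧ (κ * ‖y - x‖ < ⟪y - x, ν⟫ → y ∉ Ω)

/-- The boundary points at which the outward unit normal exists.  By Rademacher's theorem these
are almost all points of `∂Ω` when `Ω` is a Lipschitz domain. -/
def regularBoundary {n : ℕ} (Ω : Set (Euc n)) : Set (Euc n) :=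
  {x ∈ frontier Ω | ∃ ν, IsOutwardUnitNormal Ω x ν}

open Classical in
/-- The outward unit normal `n̂(x)` (with value `0` at points where there is none). -/
noncomputable def outwardNormal {n : ℕ} (Ω : Set (Euc n)) (x : Euc n) : Euc n :=
  if hx : ∃ ν, IsOutwardUnitNormal Ω x ν then hx.choose else 0

/-- `Du` is the weak gradient of `u` on the open set `Ω`. -/
def IsWeakGradient {n m : ℕ} (Ω : Set (Euc n)) (u : Euc n → Euc m) (Du : Euc n → Grad n m) :
    Prop :=
  ∀ ψ : Euc n → ℝ, ContDiff ℝ ∞ ψ → HasCompactSupport ψ → tsupport ψ ⊆ Ω → ∀ v : Euc n,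
    ∫ x in Ω, (fderiv ℝ ψ x v) • u x = -∫ x in Ω, ψ x • Du x v

/-- `u` belongs to `W^{1,p}(Ω; ℝᵐ)` and `Du` is (a representative of) its weak gradient. -/
structure IsSobolev {n m : ℕ} (Ω : Set (Euc n)) (p : ℝ) (u : Euc n → Euc m)
    (Du : Euc n → Grad n m) : Prop where
  memLp : MemLp u (ENNReal.ofReal p) (volume.restrict Ω)
  memLp_grad : MemLp Du (ENNReal.ofReal p) (volume.restrict Ω)
  isWeakGradient : IsWeakGradient Ω u Du

/-- `w` is (a representative of) the trace on `∂Ω` of `u ∈ W^{1,p}(Ω; ℝᵐ)`, where `Du = ∇u`: the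
trace operator `W^{1,p}(Ω) → L^p(∂Ω)` is the extension by continuity of the restriction
`s ↦ s|_{∂Ω}` of maps `s` that are smooth up to the boundary. -/
def IsTrace {n m : ℕ} (Ω : Set (Euc n)) (p : ℝ) (u : Euc n → Euc m) (Du : Euc n → Grad n m)
    (w : Euc n → Euc m) : Prop :=
  MemLp w (ENNReal.ofReal p) (surfaceMeasure Ω) ∧
    ∃ s : ℕ → Euc n → Euc m, (∀ k, ContDiff ℝ ∞ (s k)) ∧
      Tendsto (fun k => eLpNorm (fun x => s k x - u x) (ENNReal.ofReal p) (volume.restrict Ω))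
        atTop (𝓝 0) ∧
      Tendsto (fun k => eLpNorm (fun x => fderiv ℝ (s k) x - Du x) (ENNReal.ofReal p)
        (volume.restrict Ω)) atTop (𝓝 0) ∧
      Tendsto (fun k => eLpNorm (fun x => s k x - w x) (ENNReal.ofReal p) (surfaceMeasure Ω))
        atTop (𝓝 0)

/-- The data of the integral variational problem, with the standing assumptions on them. -/
structure VariationalProblem (n m : ℕ) where
  /-- the domain -/
  Ω : Set (Euc n)
  /-- the Sobolev exponent -/
  p : ℝ
  /-- bulk integrand of the functional -/
  f : Euc n → Euc m → Grad n m → ℝ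
  /-- boundary integrand of the functional -/
  g : Euc n → Euc m → ℝ
  /-- bulk integrand of the integral constraint -/
  a : Euc n → Euc m → Grad n m → ℝ
  /-- boundary integrand of the integral constraint -/
  b : Euc n → Euc m → ℝ
  /-- pointwise constraint in the bulk -/
  c : Euc n → Euc m → Grad n m → ℝ
  /-- pointwise constraint on the boundary -/
  d : Euc n → Euc m → ℝ
  lipschitz : IsLipschitzDomain Ω
  one_lt_p : 1 < p
  f_cont : ContinuousOn (fun q : Euc n × Euc m × Grad n m => f q.1 q.2.1 q.2.2) (Ω ×ˢ univ)
  a_cont : ContinuousOn (fun q : Euc n × Euc m × Grad n m => a q.1 q.2.1 q.2.2) (Ω ×ˢ univ)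
  c_cont : ContinuousOn (fun q : Euc n × Euc m × Grad n m => c q.1 q.2.1 q.2.2) (Ω ×ˢ univ)
  g_cont : ContinuousOn (fun q : Euc n × Euc m => g q.1 q.2) (frontier Ω ×ˢ univ)
  b_cont : ContinuousOn (fun q : Euc n × Euc m => b q.1 q.2) (frontier Ω ×ˢ univ)
  d_cont : ContinuousOn (fun q : Euc n × Euc m => d q.1 q.2) (frontier Ω ×ˢ univ)
  f_growth : ∃ C : ℝ, ∀ᵐ x ∂(volume.restrict Ω), ∀ y z, |f x y z| ≤ C * (1 + ‖y‖ ^ p + ‖z‖ ^ p)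
  a_growth : ∃ C : ℝ, ∀ᵐ x ∂(volume.restrict Ω), ∀ y z, |a x y z| ≤ C * (1 + ‖y‖ ^ p + ‖z‖ ^ p)
  g_growth : ∃ C : ℝ, ∀ᵐ x ∂(surfaceMeasure Ω), ∀ y, |g x y| ≤ C * (1 + ‖y‖ ^ p)
  b_growth : ∃ C : ℝ, ∀ᵐ x ∂(surfaceMeasure Ω), ∀ y, |b x y| ≤ C * (1 + ‖y‖ ^ p)

namespace VariationalProblem

variable {n m : ℕ} (P : VariationalProblem n m)

/-- The functional `Ψ(u) = ∫_Ω f(x,u,∇u) dx + ∫_{∂Ω} g(x,u) dS`, where `Du = ∇u` and `w` is the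
trace of `u`. -/
noncomputable def Ψ (u : Euc n → Euc m) (Du : Euc n → Grad n m) (w : Euc n → Euc m) : ℝ :=
  (∫ x in P.Ω, P.f x (u x) (Du x)) + ∫ x, P.g x (w x) ∂(surfaceMeasure P.Ω)

/-- `u ∈ W^{1,p}(Ω; ℝᵐ)`, with weak gradient `Du` and trace `w`, satisfies the constraints. -/
structure Admissible (u : Euc n → Euc m) (Du : Euc n → Grad n m) (w : Euc n → Euc m) :
    Prop where
  isSobolev : IsSobolev P.Ω P.p u Du
  isTrace : IsTrace P.Ω P.p u Du w
  integral_constraint :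
    (∫ x in P.Ω, P.a x (u x) (Du x)) + ∫ x, P.b x (w x) ∂(surfaceMeasure P.Ω) = 0
  bulk_constraint : ∀ᵐ x ∂(volume.restrict P.Ω), P.c x (u x) (Du x) = 0
  boundary_constraint : ∀ᵐ x ∂(surfaceMeasure P.Ω), P.d x (w x) = 0

/-- The optimal value `F*`, an extended real number. -/
noncomputable def optimalValue : EReal :=
  ⨅ (u : Euc n → Euc m) (Du : Euc n → Grad n m) (w : Euc n → Euc m)
    (_ : P.Admissible u Du w), ((P.Ψ u Du w : ℝ) : EReal)

/-- The derivative of `φ` on `Ω̄ × ℝᵐ` (one-sided at boundary points). -/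
noncomputable def dφ (φ : Euc n × Euc m → Euc n) (x : Euc n) (y : Euc m) :
    Euc n × Euc m →L[ℝ] Euc n :=
  fderivWithin ℝ φ (closure P.Ω ×ˢ univ) (x, y)

/-- The partial derivative `∂φᵢ/∂xₖ (x, y)`. -/
noncomputable def partialX (φ : Euc n × Euc m → Euc n) (i k : Fin n) (x : Euc n) (y : Euc m) :
    ℝ :=
  P.dφ φ x y (EuclideanSpace.single k 1, 0) i

/-- The partial derivative `∂φᵢ/∂yⱼ (x, y)`. -/
noncomputable def partialY (φ : Euc n × Euc m → Euc n) (i : Fin n) (j : Fin m) (x : Euc n)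
    (y : Euc m) : ℝ :=
  P.dφ φ x y (0, EuclideanSpace.single j 1) i

/-- The space `Φ_p` of `C¹` fields `φ : Ω̄ × ℝᵐ → ℝⁿ` with the growth conditions. -/
structure MemΦ (φ : Euc n × Euc m → Euc n) : Prop where
  contDiffOn : ContDiffOn ℝ 1 φ (closure P.Ω ×ˢ univ)
  growth_y : ∃ C : ℝ, ∀ x ∈ closure P.Ω, ∀ y : Euc m,
    ∑ i, ∑ j, |P.partialY φ i j x y| ≤ C * (1 + ‖y‖ ^ (P.p - 1))
  growth_x : ∃ C : ℝ, ∀ x ∈ closure P.Ω, ∀ y : Euc m,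
    (∑ i, |φ (x, y) i|) + ∑ i, |P.partialX φ i i x y| ≤ C * (1 + ‖y‖ ^ P.p)

/-- The total divergence `𝒟φ(x,y,z) = ∑ᵢ ∂φᵢ/∂xᵢ + ∑ᵢ ∑ⱼ ∂φᵢ/∂yⱼ z_{ji}`. -/
noncomputable def totalDiv (φ : Euc n × Euc m → Euc n) (x : Euc n) (y : Euc m)
    (z : Grad n m) : ℝ :=
  (∑ i, P.partialX φ i i x y) + ∑ i, ∑ j, P.partialY φ i j x y * matEntry z j i

/-- `F^{φ,η,h}(x,y,z) = f(x,y,z) + 𝒟φ(x,y,z) - η a(x,y,z) - h(x)`. -/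
noncomputable def bigF (φ : Euc n × Euc m → Euc n) (η : ℝ) (h : Euc n → ℝ)
    (x : Euc n) (y : Euc m) (z : Grad n m) : ℝ :=
  P.f x y z + P.totalDiv φ x y z - η * P.a x y z - h x

/-- `G^{φ,η,ℓ}(x,y) = g(x,y) - φ(x,y) · n̂(x) - η b(x,y) - ℓ(x)`. -/
noncomputable def bigG (φ : Euc n × Euc m → Euc n) (η : ℝ) (l : Euc n → ℝ)
    (x : Euc n) (y : Euc m) : ℝ :=
  P.g x y - ⟪φ (x, y), outwardNormal P.Ω x⟫ - η * P.b x y - l x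

/-- The set `Γ ⊆ Ω̄ × ℝᵐ × ℝ^{m × n}` where `c = 0`. -/
def Γ : Set (Euc n × Euc m × Grad n m) :=
  {q | q.1 ∈ closure P.Ω ∧ P.c q.1 q.2.1 q.2.2 = 0}

/-- The set `Λ ⊆ ∂Ω × ℝᵐ` where `d = 0`. -/
def Λ : Set (Euc n × Euc m) :=
  {q | q.1 ∈ frontier P.Ω ∧ P.d q.1 q.2 = 0}

/-- The set `𝔹` of tuples `(φ, η, h, ℓ)` admissible for the pointwise dual relaxation.  The
inequality `G ≥ 0` is imposed at the points of `Λ` where `G`, i.e. the normal, is defined. -/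
structure MemB (φ : Euc n × Euc m → Euc n) (η : ℝ) (h l : Euc n → ℝ) : Prop where
  memΦ : P.MemΦ φ
  h_cont : ContinuousOn h (closure P.Ω)
  l_cont : ContinuousOn l (frontier P.Ω)
  F_nonneg : ∀ q ∈ P.Γ, 0 ≤ P.bigF φ η h q.1 q.2.1 q.2.2
  G_nonneg : ∀ q ∈ P.Λ, q.1 ∈ regularBoundary P.Ω → 0 ≤ P.bigG φ η l q.1 q.2

/-- The dual objective `∫_Ω h dx + ∫_{∂Ω} ℓ dS`. -/
noncomputable def dualObjective (h l : Euc n → ℝ) : ℝ :=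
  (∫ x in P.Ω, h x) + ∫ x, l x ∂(surfaceMeasure P.Ω)

/-- The optimal value `L_pdr` of the pointwise dual relaxation, an extended real number. -/
noncomputable def dualValue : EReal :=
  ⨆ (φ : Euc n × Euc m → Euc n) (η : ℝ) (h : Euc n → ℝ) (l : Euc n → ℝ)
    (_ : P.MemB φ η h l), ((P.dualObjective h l : ℝ) : EReal)

end VariationalProblem

/-! Integrate `F^{φ,η,h}` along `(u, ∇u)` over `Ω` and `G^{φ,η,ℓ}` along the trace over `∂Ω`, and
add. The divergence theorem makes `∫ 𝒟φ(x,u,∇u) dx` cancel `∫ φ(x,u)·n̂ dS`, and the integral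
constraint removes the terms with `η`. What remains is `Ψ(u) - (∫ h + ∫ ℓ)`
(`MemB.integral_bigF_add_integral_bigG`), at most `2ε` because both numbers are within `ε` of the
optimal value on the relevant side. The pointwise constraints make both integrands nonnegative
almost everywhere along `u`, so Markov's inequality gives the bound.

The substance is the divergence theorem for Lipschitz domains, with Hausdorff surface measure and
Sobolev maps, which is built from the following ingredients.

Area formula: a graph over `e^⊥` carries the surface density `‖∇γ - e‖`
(`euclideanHausdorffMeasure_restrict_graph`).

Epigraphs: if translation by `t • a`, `t ≥ 0`, maps the epigraph into itself, then the integral of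
`V(· + t a) - V` over it is minus the mass of a thin layer above the graph. Dividing by `t` and
letting `t → 0` gives the theorem for `∂ₐV`; such `a` span all directions
(`integral_epigraph_fderiv`).

Domains: charts and a partition of unity (`IsLipschitzDomain.integral_fderiv`). The same charts and
Rademacher's theorem show that the normal exists almost everywhere, so that `G ≥ 0` is available
where it is needed.

Sobolev maps: for smooth `s`, `𝒟φ(x,s,∇s)` is the divergence of `φ(x,s(x))`. The growth conditions
on `φ` make both sides of the identity continuous under the convergence that defines the trace
(`tendsto_integral_of_growth`, `MemΦ.integral_totalDiv`). -/

/-! ### Hausdorff measure of images and the area formula. -/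

open scoped NNReal in
/-- A map which increases distances by a factor at most `K` compared to another map `A` increases
Hausdorff measures by a factor at most `K ^ d`. -/
theorem euclideanHausdorffMeasure_image_le_of_edist_le {X Y Z : Type*} [MetricSpace Y]
    [MeasurableSpace Y] [BorelSpace Y] [MetricSpace Z] [MeasurableSpace Z] [BorelSpace Z]
    {A : X → Y} {f : X → Z} {t : Set X} {K : ℝ≥0}
    (h : ∀ x ∈ t, ∀ y ∈ t, edist (f x) (f y) ≤ K * edist (A x) (A y)) (d : ℕ) :
    (Measure.euclideanHausdorffMeasure d : Measure Z) (f '' t) ≤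
      (K : ℝ≥0∞) ^ d * (Measure.euclideanHausdorffMeasure d : Measure Y) (A '' t) := by
  rcases t.eq_empty_or_nonempty with rfl | ⟨x₀, hx₀⟩
  · simp
  have : Nonempty X := ⟨x₀⟩
  -- Points of `t` with equal `A`-values have equal `f`-values, so `f` factors through `A` on `t`,
  -- by a map that is `K`-Lipschitz on `A '' t`.
  set g : Y → Z := fun y => f (Function.invFunOn A t y)
  have hinv : ∀ y ∈ A '' t, Function.invFunOn A t y ∈ t ∧ A (Function.invFunOn A t y) = y :=
    fun y hy => ⟨Function.invFunOn_mem hy, Function.invFunOn_eq hy⟩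
  have hg : LipschitzOnWith K g (A '' t) := by
    intro y hy y' hy'
    have := h _ (hinv y hy).1 _ (hinv y' hy').1
    rwa [(hinv y hy).2, (hinv y' hy').2] at this
  have himg : f '' t = g '' (A '' t) := by
    rw [image_image]
    refine image_congr fun x hx => ?_
    have h1 := hinv (A x) (mem_image_of_mem A hx)
    have := h x hx _ h1.1
    rw [h1.2, edist_self, mul_zero, nonpos_iff_eq_zero, edist_eq_zero] at this
    exact this
  rw [himg]
  simp only [Measure.euclideanHausdorffMeasure_def, Measure.smul_apply]
  have := hg.hausdorffMeasure_image_le (d := d) (by positivity)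
  rw [ENNReal.rpow_natCast] at this
  calc _ ≤ _ • ((K : ℝ≥0∞) ^ d * (μH[d] : Measure Y) (A '' t)) := by gcongr
    _ = _ := by rw [ENNReal.smul_def, ENNReal.smul_def, smul_eq_mul, smul_eq_mul]; ring

section Area

variable {E F : Type*} [NormedAddCommGroup E] [InnerProductSpace ℝ E]
  [NormedAddCommGroup F] [InnerProductSpace ℝ F]

/-- As `L` is expanding, the error `ε ‖x - y‖` is at most `ε ‖L x - L y‖`. The additive error thus
becomes a factor `1 + ε` on distances, and here `1 - ε` in the companion bound below. -/
theorem ApproximatesLinearOn.euclideanHausdorffMeasure_image_le [MeasurableSpace F] [BorelSpace F]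
    {f : E → F} {L : E →L[ℝ] F}
    {t : Set E} {ε : ℝ} (hε : 0 < ε) (hf : ApproximatesLinearOn f L t ε.toNNReal)
    (hL : ∀ v, ‖v‖ ≤ ‖L v‖) (d : ℕ) :
    (Measure.euclideanHausdorffMeasure d : Measure F) (f '' t) ≤
      ENNReal.ofReal ((1 + ε) ^ d) *
        (Measure.euclideanHausdorffMeasure d : Measure F) (L '' t) := by
  rw [ENNReal.ofReal_pow (by positivity)]
  refine euclideanHausdorffMeasure_image_le_of_edist_le (K := (1 + ε).toNNReal)
    (fun x hx y hy => ?_) d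
  rw [edist_eq_enorm_sub, edist_eq_enorm_sub, ← ofReal_norm, ← ofReal_norm, ← ENNReal.ofReal,
    ← ENNReal.ofReal_mul (by positivity)]
  apply ENNReal.ofReal_le_ofReal
  have h1 := hf x hx y hy
  rw [Real.coe_toNNReal _ hε.le] at h1
  have h2 := hL (x - y)
  rw [map_sub] at h1 h2
  have h3 := norm_sub_norm_le (f x - f y) (L x - L y)
  nlinarith

theorem ApproximatesLinearOn.le_euclideanHausdorffMeasure_image [MeasurableSpace F] [BorelSpace F]
    {f : E → F} {L : E →L[ℝ] F}
    {t : Set E} {ε : ℝ} (hε : 0 < ε) (hε1 : ε < 1) (hf : ApproximatesLinearOn f L t ε.toNNReal)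
    (hL : ∀ v, ‖v‖ ≤ ‖L v‖) (d : ℕ) :
    (Measure.euclideanHausdorffMeasure d : Measure F) (L '' t) ≤
      ENNReal.ofReal ((1 - ε)⁻¹ ^ d) *
        (Measure.euclideanHausdorffMeasure d : Measure F) (f '' t) := by
  have h1ε : 0 < 1 - ε := by linarith
  rw [ENNReal.ofReal_pow (by positivity)]
  refine euclideanHausdorffMeasure_image_le_of_edist_le (K := ((1 - ε)⁻¹).toNNReal)
    (fun x hx y hy => ?_) d
  rw [edist_eq_enorm_sub, edist_eq_enorm_sub, ← ofReal_norm, ← ofReal_norm, ← ENNReal.ofReal,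
    ← ENNReal.ofReal_mul (by positivity)]
  apply ENNReal.ofReal_le_ofReal
  rw [← div_eq_inv_mul, le_div_iff₀ h1ε]
  have h1 := hf x hx y hy
  rw [Real.coe_toNNReal _ hε.le] at h1
  have h2 := hL (x - y)
  rw [map_sub] at h1 h2
  have h3 := norm_sub_norm_le (L x - L y) (f x - f y)
  rw [norm_sub_rev (L x - L y)] at h3
  nlinarith

variable [FiniteDimensional ℝ E] [MeasurableSpace E] [BorelSpace E]

theorem LinearMap.euclideanHausdorffMeasure_image_eq_volume [MeasurableSpace F] [BorelSpace F]
    (L : E →ₗ[ℝ] F) (t : Set E) :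
    (Measure.euclideanHausdorffMeasure (Module.finrank ℝ E) : Measure F) (L '' t) =
      ENNReal.ofReal L.normDet * volume t := by
  rw [← InnerProductSpace.euclideanHausdorffMeasure_eq_volume]
  simp only [Measure.euclideanHausdorffMeasure_def, Measure.smul_apply,
    LinearMap.hausdorffMeasure_image]
  rw [ENNReal.smul_def, ENNReal.smul_def, smul_eq_mul, smul_eq_mul]; ring

/-- A decomposition of the domain of a differentiable map into pieces
on which the map is almost linear and a function `J ≥ 1` is almost constant. -/
theorem exists_partition_approximatesLinearOn_almost_const [FiniteDimensional ℝ F] (f : E → F) {s : Set E}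
    (hs : MeasurableSet s) {f' : E → E →L[ℝ] F} (hf' : ∀ x ∈ s, HasFDerivWithinAt f (f' x) s x)
    {J : E → ℝ} (hJm : Measurable J) (hJ1 : ∀ x ∈ s, 1 ≤ J x) {ε : ℝ} (hε : 0 < ε) :
    ∃ (T : ℕ × ℕ → Set E) (y : ℕ × ℕ → E), (∀ i, MeasurableSet (T i)) ∧
      Pairwise (Function.onFun Disjoint T) ∧ ⋃ i, T i = s ∧
      ∀ i, (T i).Nonempty → y i ∈ s ∧ ApproximatesLinearOn f (f' (y i)) (T i) ε.toNNReal ∧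
        ∀ x ∈ T i, J x ≤ (1 + ε) * J (y i) ∧ J (y i) ≤ (1 + ε) * J x := by
  classical
  -- On a level of `⌊J / ε⌋₊` the values of `J` differ by less than `ε`; since `J ≥ 1`, this is a
  -- relative error `1 + ε`.
  set S : ℕ → Set E := fun k => s ∩ {x | ⌊J x / ε⌋₊ = k} with hS
  have hSm : ∀ k, MeasurableSet (S k) := fun k =>
    hs.inter (measurableSet_eq_fun (Nat.measurable_floor.comp (hJm.div_const ε)) measurable_const)
  have hSd : ∀ k, ∀ x ∈ S k, HasFDerivWithinAt f (f' x) (S k) x := fun k x hx =>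
    (hf' x hx.1).mono inter_subset_left
  have key := fun k => exists_partition_approximatesLinearOn_of_hasFDerivWithinAt f (S k) f'
    (hSd k) (fun _ => ε.toNNReal) (fun _ => (Real.toNNReal_pos.2 hε).ne')
  choose t A htd htm hcov happ hA using key
  have hy : ∀ k n, ∃ y, (S k).Nonempty → y ∈ S k ∧ A k n = f' y := by
    intro k n
    by_cases h : (S k).Nonempty
    · obtain ⟨y, hy, hyA⟩ := hA k h n
      exact ⟨y, fun _ => ⟨hy, hyA⟩⟩
    · exact ⟨0, fun h' => absurd h' h⟩
  choose y hy using hy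
  refine ⟨fun i => S i.1 ∩ t i.1 i.2, fun i => y i.1 i.2, fun i => (hSm _).inter (htm _ _), ?_, ?_,
    ?_⟩
  · rintro ⟨k, n⟩ ⟨k', n'⟩ hne
    rw [Function.onFun, Set.disjoint_left]
    rintro x ⟨hx1, hx2⟩ ⟨hx3, hx4⟩
    have hk : k = k' := hx1.2.symm.trans hx3.2
    subst hk
    have hn : n ≠ n' := fun h => hne (by rw [h])
    exact Set.disjoint_left.1 (htd k hn) hx2 hx4
  · ext x
    simp only [mem_iUnion]
    constructor
    · rintro ⟨i, hi, -⟩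
      exact hi.1
    · intro hx
      have hxS : x ∈ S ⌊J x / ε⌋₊ := ⟨hx, rfl⟩
      obtain ⟨n, hn⟩ := mem_iUnion.1 (hcov _ hxS)
      exact ⟨(_, n), hxS, hn⟩
  · rintro ⟨k, n⟩ ⟨x₀, hx₀, -⟩
    obtain ⟨hyS, hyA⟩ := hy k n ⟨x₀, hx₀⟩
    have hclose : ∀ a ∈ S k, ∀ b ∈ S k, J a ≤ (1 + ε) * J b := by
      intro a ha b hb
      have ha1 := hJ1 a ha.1
      have hb1 := hJ1 b hb.1
      have ha2 : ⌊J a / ε⌋₊ = k := ha.2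
      have hb2 : ⌊J b / ε⌋₊ = k := hb.2
      have h1 := Nat.lt_floor_add_one (J a / ε)
      have h2 := Nat.floor_le (show 0 ≤ J b / ε by positivity)
      rw [ha2, div_lt_iff₀ hε] at h1
      rw [hb2, le_div_iff₀ hε] at h2
      nlinarith
    exact ⟨hyS.1, hyA ▸ happ k n, fun x hx => ⟨hclose x hx.1 _ hyS, hclose _ hyS x hx.1⟩⟩

/-- The area formula, for injective maps with expanding derivative. -/
theorem euclideanHausdorffMeasure_image_eq_lintegral_normDet [FiniteDimensional ℝ F]
    [MeasurableSpace F] [BorelSpace F] {f : E → F} {s : Set E}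
    (hs : MeasurableSet s) {f' : E → E →L[ℝ] F} (hf' : ∀ x ∈ s, HasFDerivWithinAt f (f' x) s x)
    (hexp : ∀ x ∈ s, ∀ v, ‖v‖ ≤ ‖f' x v‖) (hinj : InjOn f s)
    {J : E → ℝ} (hJm : Measurable J) (hJ : ∀ x ∈ s, J x = (f' x : E →ₗ[ℝ] F).normDet)
    (hJ1 : ∀ x ∈ s, 1 ≤ J x) :
    (Measure.euclideanHausdorffMeasure (Module.finrank ℝ E) : Measure F) (f '' s) =
      ∫⁻ x in s, ENNReal.ofReal (J x) := by
  set d := Module.finrank ℝ E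
  set μ : Measure F := Measure.euclideanHausdorffMeasure d
  have hcont : ContinuousOn f s := fun x hx => (hf' x hx).continuousWithinAt
  -- On each piece `f` is compared with the linear map `f' (y i)`, for which the formula is exact.
  -- All losses are factors tending to `1` with `ε`. Injectivity makes the images of the pieces
  -- disjoint and measurable, so the estimates can be summed.
  have key : ∀ ε : ℝ, 0 < ε → ε < 1 →
      μ (f '' s) ≤ ENNReal.ofReal ((1 + ε) ^ d * (1 + ε)) * ∫⁻ x in s, ENNReal.ofReal (J x) ∧
      ∫⁻ x in s, ENNReal.ofReal (J x) ≤
        ENNReal.ofReal ((1 + ε) * (1 - ε)⁻¹ ^ d) * μ (f '' s) := by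
    intro ε hε hε1
    have h1ε : 0 < 1 - ε := by linarith
    obtain ⟨T, y, hTm, hTd, hTs, hT⟩ :=
      exists_partition_approximatesLinearOn_almost_const f hs hf' hJm hJ1 hε
    have hTsub : ∀ i, T i ⊆ s := fun i => hTs ▸ subset_iUnion T i
    have hμ : μ (f '' s) = ∑' i, μ (f '' T i) := by
      rw [← hTs, image_iUnion, measure_iUnion]
      · intro i j hij
        refine Set.disjoint_left.2 ?_
        rintro _ ⟨a, ha, rfl⟩ ⟨b, hb, hab⟩
        rw [hinj (hTsub j hb) (hTsub i ha) hab] at hb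
        exact Set.disjoint_left.1 (hTd hij) ha hb
      · exact fun i => (hTm i).image_of_continuousOn_injOn (hcont.mono (hTsub i))
          (hinj.mono (hTsub i))
    have hint : ∫⁻ x in s, ENNReal.ofReal (J x) = ∑' i, ∫⁻ x in T i, ENNReal.ofReal (J x) := by
      rw [← hTs, lintegral_iUnion hTm hTd]
    rw [hμ, hint, ← ENNReal.tsum_mul_left, ← ENNReal.tsum_mul_left]
    constructor
    · refine ENNReal.tsum_le_tsum fun i => ?_
      rcases (T i).eq_empty_or_nonempty with h | h
      · simp [h]
      obtain ⟨hyi, happ, hclose⟩ := hT i h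
      calc μ (f '' T i) ≤ ENNReal.ofReal ((1 + ε) ^ d) * μ (f' (y i) '' T i) :=
            happ.euclideanHausdorffMeasure_image_le hε (hexp _ hyi) d
        _ = ENNReal.ofReal ((1 + ε) ^ d) * (ENNReal.ofReal (J (y i)) * volume (T i)) := by
            rw [hJ _ hyi]
            exact congrArg _ (LinearMap.euclideanHausdorffMeasure_image_eq_volume _ _)
        _ = ENNReal.ofReal ((1 + ε) ^ d) * ∫⁻ x in T i, ENNReal.ofReal (J (y i)) := by
            rw [setLIntegral_const]
        _ ≤ ENNReal.ofReal ((1 + ε) ^ d) *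
              ∫⁻ x in T i, ENNReal.ofReal (1 + ε) * ENNReal.ofReal (J x) := by
            gcongr 1
            refine setLIntegral_mono' (hTm i) fun x hx => ?_
            rw [← ENNReal.ofReal_mul (by positivity)]
            exact ENNReal.ofReal_le_ofReal (hclose x hx).2
        _ = _ := by
            rw [lintegral_const_mul _ hJm.ennreal_ofReal, ← mul_assoc,
              ← ENNReal.ofReal_mul (by positivity)]
    · refine ENNReal.tsum_le_tsum fun i => ?_
      rcases (T i).eq_empty_or_nonempty with h | h
      · simp [h]
      obtain ⟨hyi, happ, hclose⟩ := hT i h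
      calc ∫⁻ x in T i, ENNReal.ofReal (J x)
          ≤ ∫⁻ x in T i, ENNReal.ofReal ((1 + ε) * J (y i)) :=
            setLIntegral_mono' (hTm i) fun x hx => ENNReal.ofReal_le_ofReal (hclose x hx).1
        _ = ENNReal.ofReal (1 + ε) * (ENNReal.ofReal (J (y i)) * volume (T i)) := by
            rw [setLIntegral_const, ENNReal.ofReal_mul (by positivity), mul_assoc]
        _ = ENNReal.ofReal (1 + ε) * μ (f' (y i) '' T i) := by
            rw [hJ _ hyi]
            exact congrArg _ (LinearMap.euclideanHausdorffMeasure_image_eq_volume _ _).symm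
        _ ≤ ENNReal.ofReal (1 + ε) * (ENNReal.ofReal ((1 - ε)⁻¹ ^ d) * μ (f '' T i)) := by
            gcongr
            exact happ.le_euclideanHausdorffMeasure_image hε hε1 (hexp _ hyi) d
        _ = _ := by rw [← mul_assoc, ← ENNReal.ofReal_mul (by positivity)]
  have lim : ∀ (c : ℝ → ℝ) (X : ℝ≥0∞), ContinuousAt c 0 → c 0 = 1 →
      Tendsto (fun ε => ENNReal.ofReal (c ε) * X) (𝓝[>] 0) (𝓝 X) := by
    intro c X hc hc0
    have h1 : Tendsto (fun ε => ENNReal.ofReal (c ε)) (𝓝[>] 0) (𝓝 1) := by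
      have := ENNReal.tendsto_ofReal 
        (hc.tendsto.mono_left (nhdsWithin_le_nhds (s := Ioi 0)))
      rwa [hc0, ENNReal.ofReal_one] at this
    simpa using ENNReal.Tendsto.mul_const h1 (Or.inl one_ne_zero)
  have hev : ∀ᶠ ε : ℝ in 𝓝[>] 0, 0 < ε ∧ ε < 1 := Ioo_mem_nhdsGT one_pos
  apply le_antisymm
  · refine ge_of_tendsto (lim (fun ε => (1 + ε) ^ d * (1 + ε)) _ (by fun_prop) (by simp)) ?_
    filter_upwards [hev] with ε hε using (key ε hε.1 hε.2).1
  · refine ge_of_tendsto (lim (fun ε => (1 + ε) * (1 - ε)⁻¹ ^ d) _ ?_ (by simp)) ?_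
    · have : ContinuousAt (fun ε : ℝ => (1 - ε)⁻¹) 0 :=
        ContinuousAt.inv₀ (by fun_prop) (by norm_num)
      fun_prop
    · filter_upwards [hev] with ε hε using (key ε hε.1 hε.2).2

end Area


/-! ### Lipschitz graphs over a hyperplane and their surface measure. -/

section Graph

variable {E : Type*} [NormedAddCommGroup E] [InnerProductSpace ℝ E]

/-- The parametrization of the graph in direction `e` of a function `γ`, over the orthogonal
complement of `e`. -/
def graphMap (e : E) (γ : E → ℝ) (y : (ℝ ∙ e)ᗮ) : E := y + γ y • e

variable {e : E} {γ : E → ℝ}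

theorem inner_orthogonal_span_right (y : (ℝ ∙ e)ᗮ) : ⟪(y : E), e⟫ = 0 := by
  rw [real_inner_comm]
  exact Submodule.mem_orthogonal_singleton_iff_inner_right.1 y.2

theorem inner_orthogonal_add_smul (he : ‖e‖ = 1) (y : (ℝ ∙ e)ᗮ) (s : ℝ) :
    ⟪(y : E) + s • e, e⟫ = s := by
  rw [inner_add_left, inner_orthogonal_span_right, inner_smul_left,
    real_inner_self_eq_norm_sq, he]
  simp

theorem exists_eq_orthogonal_add_smul (he : ‖e‖ = 1) (x : E) :
    ∃ y : (ℝ ∙ e)ᗮ, x = y + ⟪x, e⟫ • e := by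
  refine ⟨⟨x - ⟪x, e⟫ • e, ?_⟩, by simp⟩
  rw [Submodule.mem_orthogonal_singleton_iff_inner_right, inner_sub_right, inner_smul_right,
    real_inner_self_eq_norm_sq, he, real_inner_comm]
  simp

theorem norm_orthogonal_add_smul_sq (he : ‖e‖ = 1) (y : (ℝ ∙ e)ᗮ) (s : ℝ) :
    ‖(y : E) + s • e‖ ^ 2 = ‖y‖ ^ 2 + s ^ 2 := by
  rw [norm_add_sq_real, inner_smul_right, inner_orthogonal_span_right, norm_smul, he]
  simp

theorem norm_le_norm_orthogonal_add_smul (he : ‖e‖ = 1) (y : (ℝ ∙ e)ᗮ) (s : ℝ) :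
    ‖y‖ ≤ ‖(y : E) + s • e‖ := by
  have := norm_orthogonal_add_smul_sq he y s
  exact le_of_sq_le_sq (by nlinarith [sq_nonneg s]) (norm_nonneg _)

theorem inner_graphMap (he : ‖e‖ = 1) (y : (ℝ ∙ e)ᗮ) : ⟪graphMap e γ y, e⟫ = γ y :=
  inner_orthogonal_add_smul he y _

theorem graphMap_injective (he : ‖e‖ = 1) : Function.Injective (graphMap e γ) := by
  intro y y' h
  have h1 := congrArg (fun x => ⟪x, e⟫) h
  simp only [inner_graphMap he] at h1
  simp only [graphMap, h1, add_left_inj] at h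
  exact Subtype.ext h

theorem range_graphMap (he : ‖e‖ = 1) (hγ : ∀ (x : E) (t : ℝ), γ (x + t • e) = γ x) :
    range (graphMap e γ) = {x | γ x = ⟪x, e⟫} := by
  ext x
  constructor
  · rintro ⟨y, rfl⟩
    change γ _ = _
    rw [inner_graphMap he, graphMap, hγ]
  · intro (hx : γ x = ⟪x, e⟫)
    obtain ⟨y, hy⟩ := exists_eq_orthogonal_add_smul he x
    refine ⟨y, ?_⟩
    have : γ y = ⟪x, e⟫ := by rw [← hx, hy, hγ]
    rw [graphMap, this, ← hy]

theorem LipschitzWith.graphMap {K : NNReal} (h : LipschitzWith K γ) (he : ‖e‖ = 1) :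
    LipschitzWith (1 + K) (graphMap e γ) := by
  refine LipschitzWith.add (LipschitzWith.subtype_val _) ?_
  refine LipschitzWith.of_dist_le_mul fun y y' => ?_
  rw [dist_eq_norm, ← sub_smul, norm_smul, he, mul_one, ← dist_eq_norm]
  exact h.dist_le_mul _ _

/-- Invariance along `e` passes to derivatives. -/
theorem hasFDerivAt_add_smul_iff (hγ : ∀ (x : E) (t : ℝ), γ (x + t • e) = γ x) {x : E} {t : ℝ}
    {L : E →L[ℝ] ℝ} : HasFDerivAt γ L (x + t • e) ↔ HasFDerivAt γ L x := by
  have : (fun z => γ (z + t • e)) = γ := funext fun z => hγ z t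
  conv_rhs => rw [← this]
  exact (hasFDerivAt_comp_add_right (t • e)).symm

theorem differentiableAt_add_smul_iff (hγ : ∀ (x : E) (t : ℝ), γ (x + t • e) = γ x) {x : E}
    {t : ℝ} : DifferentiableAt ℝ γ (x + t • e) ↔ DifferentiableAt ℝ γ x :=
  exists_congr fun _ => hasFDerivAt_add_smul_iff hγ

theorem fderiv_add_smul (hγ : ∀ (x : E) (t : ℝ), γ (x + t • e) = γ x) (x : E) (t : ℝ) :
    fderiv ℝ γ (x + t • e) = fderiv ℝ γ x := by
  have : (fun z => γ (z + t • e)) = γ := funext fun z => hγ z t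
  conv_rhs => rw [← this]
  exact (fderiv_comp_add_right (t • e)).symm

theorem fderiv_apply_invariant (hγ : ∀ (x : E) (t : ℝ), γ (x + t • e) = γ x) (x : E) :
    fderiv ℝ γ x e = 0 := by
  by_cases h : DifferentiableAt ℝ γ x
  · have h1 : HasDerivAt (fun t : ℝ => γ (x + t • e)) (fderiv ℝ γ x e) 0 :=
      h.hasFDerivAt.hasLineDerivAt e
    simp only [hγ] at h1
    exact h1.unique (hasDerivAt_const 0 (γ x))
  · simp [fderiv_zero_of_not_differentiableAt h]

variable [FiniteDimensional ℝ E]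

/-- The downward normal vector `∇γ - e` to the graph of `γ` in direction `e`, whose norm is the
surface element. -/
noncomputable def graphNormal (e : E) (γ : E → ℝ) (x : E) : E := gradient γ x - e

theorem inner_graphNormal (x a : E) :
    ⟪graphNormal e γ x, a⟫ = fderiv ℝ γ x a - ⟪e, a⟫ := by
  rw [graphNormal, inner_sub_left, gradient, InnerProductSpace.toDual_symm_apply]

theorem inner_gradient_invariant (hγ : ∀ (x : E) (t : ℝ), γ (x + t • e) = γ x) (x : E) :
    ⟪gradient γ x, e⟫ = 0 := by
  rw [gradient, InnerProductSpace.toDual_symm_apply, fderiv_apply_invariant hγ]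

theorem norm_graphNormal_sq (he : ‖e‖ = 1) (hγ : ∀ (x : E) (t : ℝ), γ (x + t • e) = γ x)
    (x : E) : ‖graphNormal e γ x‖ ^ 2 = 1 + ‖gradient γ x‖ ^ 2 := by
  rw [graphNormal, norm_sub_sq_real, inner_gradient_invariant hγ, he]
  ring

theorem one_le_norm_graphNormal (he : ‖e‖ = 1) (hγ : ∀ (x : E) (t : ℝ), γ (x + t • e) = γ x)
    (x : E) : 1 ≤ ‖graphNormal e γ x‖ := by
  have := norm_graphNormal_sq he hγ x
  nlinarith [norm_nonneg (graphNormal e γ x), sq_nonneg ‖gradient γ x‖]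

theorem graphNormal_add_smul (hγ : ∀ (x : E) (t : ℝ), γ (x + t • e) = γ x) (x : E) (t : ℝ) :
    graphNormal e γ (x + t • e) = graphNormal e γ x := by
  rw [graphNormal, graphNormal, gradient, gradient, fderiv_add_smul hγ]

theorem norm_graphNormal_le {K : NNReal} (hL : LipschitzWith K γ) (he : ‖e‖ = 1) (x : E) :
    ‖graphNormal e γ x‖ ≤ K + 1 := by
  rw [graphNormal, ← he]
  refine (norm_sub_le _ _).trans (add_le_add_left ?_ _)
  rw [gradient, LinearIsometryEquiv.norm_map]
  exact norm_fderiv_le_of_lipschitz ℝ hL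

/-- `L* L` is the identity plus the rank-one map `v ↦ ⟪g, v⟫ g` of `e^⊥`, a transvection of
determinant `1 + ‖g‖²`. -/
theorem normDet_graph_derivative (he : ‖e‖ = 1) {g : E} (hg : ⟪g, e⟫ = 0)
    {L : (ℝ ∙ e)ᗮ →L[ℝ] E} (hL : ∀ v, L v = v + ⟪g, (v : E)⟫ • e) :
    (L : (ℝ ∙ e)ᗮ →ₗ[ℝ] E).normDet = Real.sqrt (1 + ‖g‖ ^ 2) := by
  set g' : (ℝ ∙ e)ᗮ := ⟨g, by
    rw [Submodule.mem_orthogonal_singleton_iff_inner_right, real_inner_comm, hg]⟩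
  symm
  rw [Real.sqrt_eq_iff_eq_sq (by positivity) (LinearMap.normDet_nonneg _)]
  have h1 := L.normDet_sq
  have h2 : ((L.adjoint ∘L L : (ℝ ∙ e)ᗮ →L[ℝ] (ℝ ∙ e)ᗮ) : (ℝ ∙ e)ᗮ →ₗ[ℝ] (ℝ ∙ e)ᗮ) =
      LinearMap.transvection (innerₛₗ ℝ g') g' := by
    ext1 v
    refine ext_inner_right ℝ fun w => ?_
    have : ⟪L v, L w⟫ = ⟪v, w⟫ + ⟪g', v⟫ * ⟪g', w⟫ := by
      have hew : ⟪e, (w : E)⟫ = 0 := Submodule.mem_orthogonal_singleton_iff_inner_right.1 w.2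
      rw [hL, hL, inner_add_left, inner_add_right, inner_add_right, inner_smul_left,
        inner_smul_left, inner_smul_right, inner_smul_right, inner_orthogonal_span_right,
        hew, real_inner_self_eq_norm_sq, he]
      simp [g']
    simp [ContinuousLinearMap.adjoint_inner_left, this, LinearMap.transvection.apply,
      inner_add_left, inner_smul_left]
  rw [ContinuousLinearMap.det, h2, LinearMap.transvection.det] at h1
  simp only [RCLike.ofReal_real_eq_id, id_eq] at h1
  rw [h1]
  simp [g']

variable [MeasurableSpace E] [BorelSpace E]

theorem measurable_graphNormal : Measurable (graphNormal e γ) := by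
  refine Measurable.sub_const ?_ e
  exact (InnerProductSpace.toDual ℝ E).symm.continuous.measurable.comp (measurable_fderiv ℝ γ)

/-- Integration along lines in direction `e`, then over the orthogonal complement of `e`. -/
theorem measurePreserving_orthogonal_add_smul (he : ‖e‖ = 1) :
    MeasurePreserving (fun q : (ℝ ∙ e)ᗮ × ℝ => (q.1 : E) + q.2 • e)
      (volume.prod volume) volume := by
  have h1 := ((ℝ ∙ e).measurePreserving_measurableEquivProd (0 : E)).symm
  rw [InnerProductSpace.euclideanHausdorffMeasure_eq_volume] at h1
  have h2 : MeasurePreserving (LinearIsometryEquiv.toSpanUnitSingleton (𝕜 := ℝ) e he) :=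
    LinearIsometryEquiv.measurePreserving _
  have h3 := h1.comp ((h2.prod (MeasurePreserving.id volume)).comp
    Measure.measurePreserving_swap)
  have h4 : (fun q : (ℝ ∙ e)ᗮ × ℝ => (q.1 : E) + q.2 • e) =
      ((ℝ ∙ e).measurableEquivProd (0 : E)).symm ∘
        Prod.map (LinearIsometryEquiv.toSpanUnitSingleton (𝕜 := ℝ) e he) id ∘ Prod.swap := by
    ext1 q
    simp [LinearIsometryEquiv.toSpanUnitSingleton_apply, add_comm]
  rw [h4]
  exact h3

/-- Rademacher's theorem holds almost everywhere in `E`. By Fubini almost every line parallel to `e`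
contains a point of differentiability, and invariance along `e` moves it to the base point `y`. -/
theorem ae_orthogonal_differentiableAt {K : NNReal} (hL : LipschitzWith K γ) (he : ‖e‖ = 1)
    (hγ : ∀ (x : E) (t : ℝ), γ (x + t • e) = γ x) :
    ∀ᵐ y : (ℝ ∙ e)ᗮ, DifferentiableAt ℝ γ (y : E) := by
  have h1 := (measurePreserving_orthogonal_add_smul he).quasiMeasurePreserving.ae
    (hL.ae_differentiableAt (μ := volume))
  filter_upwards [Measure.ae_ae_of_ae_prod h1] with y hy
  obtain ⟨s, hs⟩ := hy.exists
  exact (differentiableAt_add_smul_iff hγ).1 hs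

/-- The surface measure on a Lipschitz graph. -/
theorem euclideanHausdorffMeasure_restrict_graph {K : NNReal} (hL : LipschitzWith K γ)
    (he : ‖e‖ = 1) (hγ : ∀ (x : E) (t : ℝ), γ (x + t • e) = γ x) :
    (Measure.euclideanHausdorffMeasure (Module.finrank ℝ (ℝ ∙ e)ᗮ) : Measure E).restrict
        {x | γ x = ⟪x, e⟫} =
      ((volume : Measure (ℝ ∙ e)ᗮ).withDensity
        fun y => ENNReal.ofReal ‖graphNormal e γ y‖).map (graphMap e γ) := by
  have hΦL := hL.graphMap he
  have hΦ : Measurable (graphMap e γ) := hΦL.continuous.measurable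
  have hJ : Measurable fun y : (ℝ ∙ e)ᗮ => ‖graphNormal e γ y‖ :=
    (measurable_graphNormal.comp measurable_subtype_coe).norm
  ext B hB
  rw [Measure.restrict_apply hB, Measure.map_apply hΦ hB,
    withDensity_apply _ (hΦ hB), ← range_graphMap he hγ, ← image_preimage_eq_inter_range]
  -- The area formula applies over `D`. The complement of `D` is null, and so is the part of the
  -- graph above it because `graphMap` is Lipschitz.
  set D : Set (ℝ ∙ e)ᗮ := {y | DifferentiableAt ℝ γ (y : E)} with hD
  have hDm : MeasurableSet D := measurable_subtype_coe (measurableSet_of_differentiableAt ℝ γ)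
  have hDae : ∀ᵐ y : (ℝ ∙ e)ᗮ, y ∈ D := ae_orthogonal_differentiableAt hL he hγ
  have hnull : (Measure.euclideanHausdorffMeasure (Module.finrank ℝ (ℝ ∙ e)ᗮ) : Measure E)
      (graphMap e γ '' Dᶜ) = 0 := by
    have h1 := euclideanHausdorffMeasure_image_le_of_edist_le (A := id) (t := Dᶜ)
      (fun x _ y _ => hΦL x y) (Module.finrank ℝ (ℝ ∙ e)ᗮ)
    rw [image_id, InnerProductSpace.euclideanHausdorffMeasure_eq_volume,
      show volume Dᶜ = 0 from hDae, mul_zero] at h1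
    exact nonpos_iff_eq_zero.1 h1
  have hmain : (Measure.euclideanHausdorffMeasure (Module.finrank ℝ (ℝ ∙ e)ᗮ) : Measure E)
      (graphMap e γ '' (graphMap e γ ⁻¹' B ∩ D)) =
      ∫⁻ y in graphMap e γ ⁻¹' B ∩ D, ENNReal.ofReal ‖graphNormal e γ y‖ := by
    -- The derivative adds a multiple of `e` to `v ⟂ e`, hence is expanding, as the area formula
    -- above requires.
    set Φ' : (ℝ ∙ e)ᗮ → (ℝ ∙ e)ᗮ →L[ℝ] E := fun y =>
      (ℝ ∙ e)ᗮ.subtypeL + ((fderiv ℝ γ y).comp (ℝ ∙ e)ᗮ.subtypeL).smulRight e with hΦ'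
    have hΦ'v : ∀ y v, Φ' y v = v + ⟪gradient γ (y : E), (v : E)⟫ • e := fun y v => by
      simp [Φ', gradient, InnerProductSpace.toDual_symm_apply]
    refine euclideanHausdorffMeasure_image_eq_lintegral_normDet (f' := Φ')
      ((hΦ hB).inter hDm) ?_ ?_ (graphMap_injective he).injOn hJ ?_ ?_
    · intro y hy
      have h1 : HasFDerivAt (fun y : (ℝ ∙ e)ᗮ => (y : E)) (ℝ ∙ e)ᗮ.subtypeL y :=
        (ℝ ∙ e)ᗮ.subtypeL.hasFDerivAt
      have h2 : HasFDerivAt (fun y : (ℝ ∙ e)ᗮ => γ y)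
          ((fderiv ℝ γ y).comp (ℝ ∙ e)ᗮ.subtypeL) y :=
        HasFDerivAt.comp y (DifferentiableAt.hasFDerivAt hy.2) h1
      exact (h1.add (h2.smul_const e)).hasFDerivWithinAt
    · intro y _ v
      rw [hΦ'v]
      exact norm_le_norm_orthogonal_add_smul he v _
    · intro y _
      rw [normDet_graph_derivative he (inner_gradient_invariant hγ (y : E)) (hΦ'v y),
        ← norm_graphNormal_sq he hγ, Real.sqrt_sq (norm_nonneg _)]
    · exact fun y _ => one_le_norm_graphNormal he hγ _
  have hDint : ∫⁻ y in graphMap e γ ⁻¹' B ∩ D, ENNReal.ofReal ‖graphNormal e γ y‖ =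
      ∫⁻ y in graphMap e γ ⁻¹' B, ENNReal.ofReal ‖graphNormal e γ y‖ :=
    setLIntegral_congr (inter_ae_eq_left_of_ae_eq_univ (eventuallyEq_univ.2 hDae))
  rw [← hDint, ← hmain]
  apply le_antisymm
  · calc _ ≤ (Measure.euclideanHausdorffMeasure (Module.finrank ℝ (ℝ ∙ e)ᗮ) : Measure E)
          (graphMap e γ '' (graphMap e γ ⁻¹' B ∩ D) ∪ graphMap e γ '' Dᶜ) := by
          rw [← image_union]
          refine measure_mono (image_mono fun y hy => ?_)
          by_cases hyD : y ∈ D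
          exacts [Or.inl ⟨hy, hyD⟩, Or.inr hyD]
      _ ≤ _ := (measure_union_le _ _).trans (by rw [hnull, add_zero])
  · exact measure_mono (image_mono inter_subset_left)

end Graph


/-! ### Divergence theorem on epigraphs: directions in the cone. -/

section Epigraph

variable {E : Type*} [NormedAddCommGroup E] [InnerProductSpace ℝ E]
  {e : E} {γ : E → ℝ}

theorem isOpen_epigraph (hγ : Continuous γ) : IsOpen {x | γ x < ⟪x, e⟫} :=
  isOpen_lt hγ (by fun_prop)

theorem isClosed_epigraph (hγ : Continuous γ) : IsClosed {x | γ x ≤ ⟪x, e⟫} :=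
  isClosed_le hγ (by fun_prop)

variable [FiniteDimensional ℝ E]

theorem exists_bound_of_continuous_of_eq_zero {V : E → ℝ} {T : Set E} (hV : Continuous V) {R : ℝ}
    (hR : ∀ x ∈ T, R < ‖x‖ → V x = 0) : ∃ C, 0 ≤ C ∧ ∀ x ∈ T, |V x| ≤ C := by
  obtain ⟨C, hC⟩ := (isCompact_closedBall (0 : E) R).exists_bound_of_continuousOn hV.continuousOn
  refine ⟨max C 0, le_max_right _ _, fun x hx => ?_⟩
  by_cases h : R < ‖x‖
  · rw [hR x hx h, abs_zero]
    exact le_max_right _ _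
  · exact (hC x (by simpa using h)).trans (le_max_left _ _)

/-- Differentiating the mass of a thin layer above a point of a Lipschitz graph. -/
theorem tendsto_inv_mul_integral_layer {V : E → ℝ} (hV : Continuous V) (a : E)
    {y : (ℝ ∙ e)ᗮ} (hy : DifferentiableAt ℝ γ (y : E)) :
    Tendsto (fun t : ℝ => t⁻¹ * ∫ s in γ y..(γ ((y : E) - t • a) + t * ⟪a, e⟫),
      V ((y : E) + s • e)) (𝓝[>] 0)
      (𝓝 (-(V (graphMap e γ y) * ⟪graphNormal e γ y, a⟫))) := by
  have hv : Continuous fun s : ℝ => V ((y : E) + s • e) := by fun_prop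
  have h1 : HasDerivAt (fun b => ∫ s in γ y..b, V ((y : E) + s • e)) (V (graphMap e γ y)) (γ y) :=
    intervalIntegral.integral_hasDerivAt_right (hv.intervalIntegrable _ _)
      hv.stronglyMeasurable.stronglyMeasurableAtFilter hv.continuousAt
  -- The upper limit of integration moves with speed `⟪a, e⟫ - Dγ(y) a`; the chain rule combines
  -- this with the fundamental theorem of calculus.
  have h2 : HasDerivAt (fun t : ℝ => γ ((y : E) - t • a) + t * ⟪a, e⟫)
      (-⟪graphNormal e γ y, a⟫) 0 := by
    have h3 : HasDerivAt (fun t : ℝ => γ ((y : E) + t • (-a))) (fderiv ℝ γ y (-a)) 0 :=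
      hy.hasFDerivAt.hasLineDerivAt (-a)
    have h4 : HasDerivAt (fun t : ℝ => t * ⟪a, e⟫) ⟪a, e⟫ 0 := by
      simpa using (hasDerivAt_id (0 : ℝ)).mul_const ⟪a, e⟫
    have hfun : (fun t : ℝ => γ ((y : E) - t • a) + t * ⟪a, e⟫) =
        (fun t : ℝ => γ ((y : E) + t • (-a))) + fun t => t * ⟪a, e⟫ := by
      ext t
      simp [sub_eq_add_neg]
    rw [hfun]
    refine (h3.add h4).congr_deriv ?_
    rw [inner_graphNormal, map_neg, real_inner_comm]
    ring
  have h0 : γ ((y : E) - (0 : ℝ) • a) + 0 * ⟪a, e⟫ = γ y := by simp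
  have h5 := HasDerivAt.comp (0 : ℝ) (h₂ := fun b => ∫ s in γ y..b, V ((y : E) + s • e))
    (by rw [h0]; exact h1) h2
  have h6 := h5.tendsto_slope_zero_right
  simp only [Function.comp_apply, h0, intervalIntegral.integral_same, sub_zero, zero_add,
    smul_eq_mul, mul_neg] at h6
  exact h6

variable [MeasurableSpace E] [BorelSpace E]

theorem integral_eq_integral_orthogonal_integral (he : ‖e‖ = 1) {W : E → ℝ}
    (hW : Integrable W) :
    ∫ x, W x = ∫ y : (ℝ ∙ e)ᗮ, ∫ s : ℝ, W ((y : E) + s • e) := by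
  have hmp := measurePreserving_orthogonal_add_smul he
  rw [← hmp.map_eq, integral_map hmp.measurable.aemeasurable
    (by rw [hmp.map_eq]; exact hW.aestronglyMeasurable)]
  exact integral_prod _ (hmp.integrable_comp_of_integrable hW)

/-- The increment of the integral over an epigraph under a translation is the mass of the layer
between the graph and its translate. -/
theorem integral_epigraph_translate_sub (he : ‖e‖ = 1) (hγc : Continuous γ)
    (hγ : ∀ (x : E) (t : ℝ), γ (x + t • e) = γ x) {V : E → ℝ} (hV : Continuous V) {R : ℝ}
    (hR : ∀ x, γ x ≤ ⟪x, e⟫ → R < ‖x‖ → V x = 0) {a : E}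
    (hcone : ∀ (x : E) (t : ℝ), 0 ≤ t → γ (x + t • a) ≤ γ x + t * ⟪a, e⟫) {t : ℝ} (ht : 0 ≤ t) :
    ∫ x in {x | γ x < ⟪x, e⟫}, (V (x + t • a) - V x) =
      -∫ y : (ℝ ∙ e)ᗮ, ∫ s in γ y..(γ ((y : E) - t • a) + t * ⟪a, e⟫), V ((y : E) + s • e) := by
  set U := {x | γ x < ⟪x, e⟫} with hU
  have hUm : MeasurableSet U := (isOpen_epigraph hγc).measurableSet
  -- The cone condition says `U + t a ⊆ U`. After a change of variables the difference of integrals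
  -- is minus the integral of `V` over `U \ (U + t a)`, whose slice over `y` is the interval in the
  -- statement.
  have hUt : ∀ x, x - t • a ∈ U → x ∈ U := by
    intro x hx
    have h1 := hcone (x - t • a) t ht
    have h2 : γ (x - t • a) < ⟪x - t • a, e⟫ := hx
    rw [sub_add_cancel] at h1
    rw [inner_sub_left, real_inner_smul_left] at h2
    change γ x < ⟪x, e⟫
    linarith
  have hint : IntegrableOn V U := by
    rw [← integrable_indicator_iff hUm]
    refine Integrable.mono' (g := (Metric.closedBall (0 : E) R).indicator fun x => |V x|) ?_
      (hV.aestronglyMeasurable.indicator hUm) (Eventually.of_forall fun x => ?_)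
    · rw [integrable_indicator_iff Metric.isClosed_closedBall.measurableSet]
      exact hV.abs.continuousOn.integrableOn_compact (isCompact_closedBall _ _)
    · by_cases hx : x ∈ U
      · by_cases hxR : R < ‖x‖
        · rw [indicator_of_mem hx, hR x (le_of_lt hx) hxR, norm_zero]
          exact indicator_nonneg (fun _ _ => abs_nonneg _) _
        · rw [indicator_of_mem hx, indicator_of_mem (by simpa using hxR), Real.norm_eq_abs]
      · rw [indicator_of_notMem hx, norm_zero]
        exact indicator_nonneg (fun _ _ => abs_nonneg _) _
  have hUt' : MeasurableSet ((fun x => x - t • a) ⁻¹' U) := (measurable_id.sub_const _) hUm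
  have hint' : IntegrableOn V ((fun x => x - t • a) ⁻¹' U) := hint.mono_set fun x hx => hUt x hx
  have htr : ∀ x, U.indicator (fun x => V (x + t • a)) x =
      ((fun x => x - t • a) ⁻¹' U).indicator V (x + t • a) := by
    intro x
    simp only [indicator, mem_preimage, add_sub_cancel_right]
  have hint'' : IntegrableOn (fun x => V (x + t • a)) U := by
    rw [← integrable_indicator_iff hUm]
    simp only [funext htr]
    exact ((integrable_indicator_iff hUt').2 hint').comp_add_right _
  rw [integral_sub hint'' hint, ← integral_indicator hUm]
  simp only [htr]
  rw [integral_add_right_eq_self, ← integral_indicator hUm, ← integral_sub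
    ((integrable_indicator_iff hUt').2 hint') ((integrable_indicator_iff hUm).2 hint),
    integral_eq_integral_orthogonal_integral he
      (W := fun x => ((fun x => x - t • a) ⁻¹' U).indicator V x - U.indicator V x)
      (((integrable_indicator_iff hUt').2 hint').sub ((integrable_indicator_iff hUm).2 hint)),
    ← integral_neg]
  congr 1
  ext y
  have hle : γ y ≤ γ ((y : E) - t • a) + t * ⟪a, e⟫ := by
    simpa using hcone ((y : E) - t • a) t ht
  rw [intervalIntegral.integral_of_le hle, ← integral_indicator measurableSet_Ioc, ← integral_neg]
  congr 1
  ext s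
  have hmem : (y : E) + s • e ∈ U ↔ γ y < s := by
    rw [hU, mem_ofPred_eq, hγ, inner_orthogonal_add_smul he]
  have hmem' : (y : E) + s • e ∈ (fun x => x - t • a) ⁻¹' U ↔
      γ ((y : E) - t • a) + t * ⟪a, e⟫ < s := by
    rw [mem_preimage, hU, mem_ofPred_eq, add_sub_right_comm, hγ, inner_add_left, inner_sub_left,
      inner_orthogonal_span_right, inner_smul_left, inner_smul_left, real_inner_self_eq_norm_sq, he]
    simp only [conj_trivial, one_pow, mul_one]
    constructor <;> intro h <;> linarith
  simp only [indicator, hmem, hmem', mem_Ioc]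
  split_ifs with h1 h2 h3 h4 h5 h6 <;> first | (exfalso; grind) | simp

/-- The divergence theorem on an epigraph, for derivatives in directions of the cone. -/
theorem integral_epigraph_fderiv_of_cone {K : NNReal} (hL : LipschitzWith K γ) (he : ‖e‖ = 1)
    (hγ : ∀ (x : E) (t : ℝ), γ (x + t • e) = γ x) {V : E → ℝ} (hV : Continuous V) {R : ℝ}
    (hR : ∀ x, γ x ≤ ⟪x, e⟫ → R < ‖x‖ → V x = 0)
    (hd : ∀ x, γ x < ⟪x, e⟫ → DifferentiableAt ℝ V x) {M : ℝ}
    (hM : ∀ x, γ x < ⟪x, e⟫ → ‖fderiv ℝ V x‖ ≤ M) {a : E}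
    (hcone : ∀ (x : E) (t : ℝ), 0 ≤ t → γ (x + t • a) ≤ γ x + t * ⟪a, e⟫) :
    ∫ x in {x | γ x < ⟪x, e⟫}, fderiv ℝ V x a =
      ∫ y : (ℝ ∙ e)ᗮ, V (graphMap e γ y) * ⟪graphNormal e γ y, a⟫ := by
  have hγc := hL.continuous
  have hUm : MeasurableSet {x | γ x < ⟪x, e⟫} := (isOpen_epigraph hγc).measurableSet
  have hmove : ∀ x, γ x < ⟪x, e⟫ → ∀ t : ℝ, 0 ≤ t → γ (x + t • a) < ⟪x + t • a, e⟫ := by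
    intro x hx t ht
    rw [inner_add_left, real_inner_smul_left]
    linarith [hcone x t ht]
  have hIoc : ∀ᶠ t : ℝ in 𝓝[>] 0, t ∈ Ioc (0 : ℝ) 1 := Ioc_mem_nhdsGT zero_lt_one
  -- Segments from `x` to `x + t a` stay in the epigraph, so the mean value inequality dominates the
  -- quotients by `M ‖a‖`. As `t ≤ 1`, they vanish outside the ball of radius `R + ‖a‖`.
  have lim1 : Tendsto (fun t : ℝ => ∫ x in {x | γ x < ⟪x, e⟫}, t⁻¹ * (V (x + t • a) - V x))
      (𝓝[>] 0) (𝓝 (∫ x in {x | γ x < ⟪x, e⟫}, fderiv ℝ V x a)) := by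
    apply tendsto_integral_filter_of_dominated_convergence
      ((Metric.closedBall (0 : E) (R + ‖a‖)).indicator fun _ => M * ‖a‖)
    · exact Eventually.of_forall fun t => Continuous.aestronglyMeasurable (by fun_prop)
    · filter_upwards [hIoc] with t ht
      rw [ae_restrict_iff' hUm]
      refine Eventually.of_forall fun x hx => ?_
      have hMa : 0 ≤ M * ‖a‖ :=
        mul_nonneg ((norm_nonneg _).trans (hM x hx)) (norm_nonneg _)
      by_cases hxR : x ∈ Metric.closedBall (0 : E) (R + ‖a‖)
      · rw [indicator_of_mem hxR]
        have hseg : ∀ z ∈ segment ℝ x (x + t • a), γ z < ⟪z, e⟫ := by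
          intro z hz
          rw [segment_eq_image'] at hz
          obtain ⟨θ, hθ, rfl⟩ := hz
          rw [add_sub_cancel_left]
          simp only [smul_smul]
          exact hmove x hx _ (mul_nonneg hθ.1 ht.1.le)
        have := Convex.norm_image_sub_le_of_norm_fderiv_le (𝕜 := ℝ) (f := V) (C := M)
          (fun z hz => hd z (hseg z hz)) (fun z hz => hM z (hseg z hz))
          (convex_segment x (x + t • a)) (left_mem_segment ℝ _ _) (right_mem_segment ℝ _ _)
        rw [add_sub_cancel_left, norm_smul, Real.norm_of_nonneg ht.1.le] at this
        rw [norm_mul, norm_inv, Real.norm_of_nonneg ht.1.le, inv_mul_le_iff₀ ht.1]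
        linarith
      · rw [indicator_of_notMem hxR]
        have hxR' : R + ‖a‖ < ‖x‖ := by simpa using hxR
        have hta : ‖t • a‖ ≤ ‖a‖ := by
          rw [norm_smul, Real.norm_of_nonneg ht.1.le]
          exact mul_le_of_le_one_left (norm_nonneg _) ht.2
        have h1 : V x = 0 := hR x (le_of_lt hx) (by linarith [norm_nonneg a])
        have h2 : V (x + t • a) = 0 := by
          refine hR _ (hmove x hx t ht.1.le).le ?_
          have := norm_sub_le (x + t • a) (t • a)
          rw [add_sub_cancel_right] at this
          linarith
        simp [h1, h2]
    · refine Integrable.integrableOn ?_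
      rw [integrable_indicator_iff Metric.isClosed_closedBall.measurableSet]
      exact integrableOn_const measure_closedBall_lt_top.ne
    · rw [ae_restrict_iff' hUm]
      refine Eventually.of_forall fun x hx => ?_
      have h1 : HasDerivAt (fun t : ℝ => V (x + t • a)) (fderiv ℝ V x a) 0 :=
        (hd x hx).hasFDerivAt.hasLineDerivAt a
      simpa using h1.tendsto_slope_zero_right
  obtain ⟨C, hC0, hC⟩ := exists_bound_of_continuous_of_eq_zero (T := {x | γ x ≤ ⟪x, e⟫}) hV hR
  -- The layer over `y` has thickness at most `t (K ‖a‖ + ‖a‖)` and lies in the epigraph, where `|V|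
  -- ≤ C`. This dominates the quotients, and differentiability of `γ` at almost every `y` gives the
  -- pointwise limit.
  have lim2 : Tendsto (fun t : ℝ => ∫ y : (ℝ ∙ e)ᗮ,
      t⁻¹ * ∫ s in γ y..(γ ((y : E) - t • a) + t * ⟪a, e⟫), V ((y : E) + s • e)) (𝓝[>] 0)
      (𝓝 (∫ y : (ℝ ∙ e)ᗮ, -(V (graphMap e γ y) * ⟪graphNormal e γ y, a⟫))) := by
    apply tendsto_integral_filter_of_dominated_convergence
      ((Metric.closedBall (0 : (ℝ ∙ e)ᗮ) R).indicator fun _ => C * (K * ‖a‖ + ‖a‖))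
    · refine Eventually.of_forall fun t => Continuous.aestronglyMeasurable ?_
      refine continuous_const.mul ?_
      have hcont : ∀ b : (ℝ ∙ e)ᗮ → ℝ, Continuous b →
          Continuous fun y : (ℝ ∙ e)ᗮ => ∫ s in (0 : ℝ)..b y, V ((y : E) + s • e) := by
        intro b hb
        exact intervalIntegral.continuous_parametric_intervalIntegral_of_continuous
          (f := fun (y : (ℝ ∙ e)ᗮ) (s : ℝ) => V ((y : E) + s • e))
          (by simp only [Function.uncurry_def]; fun_prop) hb
      have hsplit : ∀ y : (ℝ ∙ e)ᗮ,
          ∫ s in γ y..(γ ((y : E) - t • a) + t * ⟪a, e⟫), V ((y : E) + s • e) =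
          (∫ s in (0 : ℝ)..(γ ((y : E) - t • a) + t * ⟪a, e⟫), V ((y : E) + s • e)) -
            ∫ s in (0 : ℝ)..γ y, V ((y : E) + s • e) := by
        intro y
        have hv : Continuous fun s : ℝ => V ((y : E) + s • e) := by fun_prop
        rw [intervalIntegral.integral_interval_sub_left (hv.intervalIntegrable _ _)
          (hv.intervalIntegrable _ _)]
      simp only [hsplit]
      exact (hcont _ (by fun_prop)).sub (hcont _ (by fun_prop))
    · filter_upwards [hIoc] with t ht
      refine Eventually.of_forall fun y => ?_
      have hle : γ y ≤ γ ((y : E) - t • a) + t * ⟪a, e⟫ := by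
        simpa using hcone ((y : E) - t • a) t ht.1.le
      have hepi : ∀ s, s ∈ uIoc (γ y) (γ ((y : E) - t • a) + t * ⟪a, e⟫) →
          γ ((y : E) + s • e) ≤ ⟪(y : E) + s • e, e⟫ := by
        intro s hs
        rw [uIoc_of_le hle] at hs
        rw [hγ, inner_orthogonal_add_smul he]
        exact hs.1.le
      by_cases hyR : y ∈ Metric.closedBall (0 : (ℝ ∙ e)ᗮ) R
      · rw [indicator_of_mem hyR]
        have h1 := intervalIntegral.norm_integral_le_of_norm_le_const
          (f := fun s : ℝ => V ((y : E) + s • e)) (fun s hs => hC _ (hepi s hs))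
        have h2 : |γ ((y : E) - t • a) + t * ⟪a, e⟫ - γ y| ≤ t * (K * ‖a‖ + ‖a‖) := by
          have h3 := hL.dist_le_mul ((y : E) - t • a) y
          rw [Real.dist_eq, dist_eq_norm, sub_sub_cancel_left, norm_neg, norm_smul,
            Real.norm_of_nonneg ht.1.le] at h3
          have h4 := real_inner_le_norm a e
          rw [he, mul_one] at h4
          rw [abs_of_nonneg (by linarith)]
          have h5 := le_abs_self (γ ((y : E) - t • a) - γ y)
          nlinarith [ht.1]
        rw [norm_mul, norm_inv, Real.norm_of_nonneg ht.1.le, inv_mul_le_iff₀ ht.1]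
        calc _ ≤ C * _ := h1
          _ ≤ C * (t * (K * ‖a‖ + ‖a‖)) := by gcongr
          _ = _ := by ring
      · rw [indicator_of_notMem hyR, intervalIntegral.integral_zero_ae]
        · simp
        · refine Eventually.of_forall fun s hs => hR _ (hepi s hs) ?_
          have h1 : R < ‖y‖ := by simpa using hyR
          exact h1.trans_le (norm_le_norm_orthogonal_add_smul he y s)
    · rw [integrable_indicator_iff Metric.isClosed_closedBall.measurableSet]
      exact integrableOn_const measure_closedBall_lt_top.ne
    · filter_upwards [ae_orthogonal_differentiableAt hL he hγ] with y hy
      exact tendsto_inv_mul_integral_layer hV a hy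
  rw [integral_neg] at lim2
  have heq : ∀ᶠ t : ℝ in 𝓝[>] 0,
      ∫ x in {x | γ x < ⟪x, e⟫}, t⁻¹ * (V (x + t • a) - V x) =
      -∫ y : (ℝ ∙ e)ᗮ,
        t⁻¹ * ∫ s in γ y..(γ ((y : E) - t • a) + t * ⟪a, e⟫), V ((y : E) + s • e) := by
    filter_upwards [hIoc] with t ht
    rw [integral_const_mul, integral_const_mul,
      integral_epigraph_translate_sub he hγc hγ hV hR hcone ht.1.le, mul_neg]
  have := tendsto_nhds_unique (lim1.congr' heq) lim2.neg
  rw [this, neg_neg]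

end Epigraph


/-! ### Divergence theorem on epigraphs: all directions, and functions given only on the closed
epigraph. -/

section Epigraph

variable {E : Type*} [NormedAddCommGroup E] [InnerProductSpace ℝ E] [FiniteDimensional ℝ E]
  [MeasurableSpace E] [BorelSpace E] {e : E} {γ : E → ℝ}

theorem integrableOn_epigraph_fderiv (hγc : Continuous γ) {V : E → ℝ} {R : ℝ}
    (hR : ∀ x, γ x ≤ ⟪x, e⟫ → R < ‖x‖ → V x = 0) {M : ℝ}
    (hM : ∀ x, γ x < ⟪x, e⟫ → ‖fderiv ℝ V x‖ ≤ M) (a : E) :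
    IntegrableOn (fun x => fderiv ℝ V x a) {x | γ x < ⟪x, e⟫} := by
  have hU := isOpen_epigraph (e := e) hγc
  refine Integrable.mono' (g := (Metric.closedBall (0 : E) R).indicator fun _ => M * ‖a‖) ?_
    (measurable_fderiv_apply_const ℝ V a).aestronglyMeasurable ?_
  · refine Integrable.integrableOn ?_
    rw [integrable_indicator_iff Metric.isClosed_closedBall.measurableSet]
    exact integrableOn_const measure_closedBall_lt_top.ne
  · rw [ae_restrict_iff' hU.measurableSet]
    refine Eventually.of_forall fun x hx => ?_
    by_cases hxR : x ∈ Metric.closedBall (0 : E) R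
    · rw [indicator_of_mem hxR]
      exact (fderiv ℝ V x).le_of_opNorm_le (hM x hx) a
    · rw [indicator_of_notMem hxR]
      have hxR' : R < ‖x‖ := by simpa using hxR
      have : V =ᶠ[𝓝 x] fun _ => 0 := by
        filter_upwards [hU.mem_nhds hx, (isOpen_lt continuous_const continuous_norm).mem_nhds hxR']
          with z hz1 hz2 using hR z (le_of_lt hz1) hz2
      rw [this.fderiv_eq]
      simp

theorem integrable_graph_mul_inner {K : NNReal} (hL : LipschitzWith K γ) (he : ‖e‖ = 1)
    (hγ : ∀ (x : E) (t : ℝ), γ (x + t • e) = γ x) {V : E → ℝ} (hV : Continuous V) {R : ℝ}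
    (hR : ∀ x, γ x ≤ ⟪x, e⟫ → R < ‖x‖ → V x = 0) (a : E) :
    Integrable fun y : (ℝ ∙ e)ᗮ => V (graphMap e γ y) * ⟪graphNormal e γ y, a⟫ := by
  obtain ⟨C, hC0, hC⟩ := exists_bound_of_continuous_of_eq_zero (T := {x | γ x ≤ ⟪x, e⟫}) hV hR
  have hepi : ∀ y : (ℝ ∙ e)ᗮ, γ (graphMap e γ y) ≤ ⟪graphMap e γ y, e⟫ := fun y => by
    rw [inner_graphMap he, graphMap, hγ]
  refine Integrable.mono'
    (g := (Metric.closedBall (0 : (ℝ ∙ e)ᗮ) R).indicator fun _ => C * ((K + 1) * ‖a‖)) ?_ ?_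
    (Eventually.of_forall fun y => ?_)
  · rw [integrable_indicator_iff Metric.isClosed_closedBall.measurableSet]
    exact integrableOn_const measure_closedBall_lt_top.ne
  · refine Measurable.aestronglyMeasurable (Measurable.mul ?_ ?_)
    · exact hV.measurable.comp (hL.graphMap he).continuous.measurable
    · exact (measurable_graphNormal.comp measurable_subtype_coe).inner_const
  · by_cases hyR : y ∈ Metric.closedBall (0 : (ℝ ∙ e)ᗮ) R
    · rw [indicator_of_mem hyR, norm_mul]
      gcongr
      · exact hC _ (hepi y)
      · exact (norm_inner_le_norm _ _).trans (by gcongr; exact norm_graphNormal_le hL he _)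
    · rw [indicator_of_notMem hyR, hR _ (hepi y), zero_mul, norm_zero]
      have h1 : R < ‖y‖ := by simpa using hyR
      exact h1.trans_le (norm_le_norm_orthogonal_add_smul he y _)

/-- Both sides are linear in `a`, and the cone of admissible directions contains `e` and, for small
`κ > 0`, also `e + κ a`. Subtracting the two identities and dividing by `κ` gives the one for `a`.
-/
theorem integral_epigraph_fderiv_of_continuous {K : NNReal} (hL : LipschitzWith K γ)
    (he : ‖e‖ = 1) (hγ : ∀ (x : E) (t : ℝ), γ (x + t • e) = γ x) {V : E → ℝ} (hV : Continuous V)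
    {R : ℝ} (hR : ∀ x, γ x ≤ ⟪x, e⟫ → R < ‖x‖ → V x = 0)
    (hd : ∀ x, γ x < ⟪x, e⟫ → DifferentiableAt ℝ V x) {M : ℝ}
    (hM : ∀ x, γ x < ⟪x, e⟫ → ‖fderiv ℝ V x‖ ≤ M) (a : E) :
    ∫ x in {x | γ x < ⟪x, e⟫}, fderiv ℝ V x a =
      ∫ y : (ℝ ∙ e)ᗮ, V (graphMap e γ y) * ⟪graphNormal e γ y, a⟫ := by
  -- Along `e + κ a`, `γ` grows at most at rate `K κ ‖a‖` and the height at least at rate `1 - κ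
  -- ‖a‖`; this choice makes the first at most the second.
  obtain ⟨κ, hκ0, hκ⟩ : ∃ κ : ℝ, 0 < κ ∧ κ * ((K + 1) * ‖a‖) ≤ 1 := by
    have h0 : 0 < (K + 1) * ‖a‖ + 1 := by positivity
    refine ⟨((K + 1) * ‖a‖ + 1)⁻¹, by positivity, ?_⟩
    rw [inv_mul_le_iff₀ h0]
    linarith
  have h1 := integral_epigraph_fderiv_of_cone hL he hγ hV hR hd hM (a := e) (fun x t ht => by
    rw [hγ, real_inner_self_eq_norm_sq, he]
    linarith)
  have h2 := integral_epigraph_fderiv_of_cone hL he hγ hV hR hd hM (a := e + κ • a)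
    (fun x t ht => by
      have h3 := hL.dist_le_mul (x + t • (κ • a)) x
      rw [Real.dist_eq, dist_eq_norm, add_sub_cancel_left, norm_smul, norm_smul,
        Real.norm_of_nonneg ht, Real.norm_of_nonneg hκ0.le] at h3
      have h4 := abs_real_inner_le_norm a e
      rw [he, mul_one] at h4
      have h5 := (le_abs_self _).trans h3
      have h6 := (abs_le.1 h4).1
      rw [smul_add, ← add_assoc, add_right_comm, hγ, inner_add_left, real_inner_self_eq_norm_sq,
        he, real_inner_smul_left]
      have h7 : 0 ≤ κ * (⟪a, e⟫ + ‖a‖) := mul_nonneg hκ0.le (by linarith)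
      have h8 : 0 ≤ t * (1 + κ * ⟪a, e⟫ - K * κ * ‖a‖) := mul_nonneg ht (by nlinarith)
      nlinarith)
  simp only [map_add, map_smul, inner_add_right, inner_smul_right, smul_eq_mul, mul_add] at h2
  rw [integral_add (integrableOn_epigraph_fderiv hL.continuous hR hM e)
      ((integrableOn_epigraph_fderiv hL.continuous hR hM a).const_mul κ),
    integral_add (integrable_graph_mul_inner hL he hγ hV hR e)
      (by simpa only [mul_left_comm] using
        (integrable_graph_mul_inner hL he hγ hV hR a).const_mul κ), h1, add_right_inj] at h2
  simp only [mul_left_comm _ κ, integral_const_mul] at h2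
  exact mul_left_cancel₀ hκ0.ne' h2

/-- The divergence theorem on the epigraph of a Lipschitz function. -/
theorem integral_epigraph_fderiv {K : NNReal} (hL : LipschitzWith K γ) (he : ‖e‖ = 1)
    (hγ : ∀ (x : E) (t : ℝ), γ (x + t • e) = γ x) {V : E → ℝ}
    (hV : ContinuousOn V {x | γ x ≤ ⟪x, e⟫}) {R : ℝ}
    (hR : ∀ x, γ x ≤ ⟪x, e⟫ → R < ‖x‖ → V x = 0)
    (hd : ∀ x, γ x < ⟪x, e⟫ → DifferentiableAt ℝ V x) {M : ℝ}
    (hM : ∀ x, γ x < ⟪x, e⟫ → ‖fderiv ℝ V x‖ ≤ M) (a : E) :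
    ∫ x in {x | γ x < ⟪x, e⟫}, fderiv ℝ V x a =
      ∫ y : (ℝ ∙ e)ᗮ, V (graphMap e γ y) * ⟪graphNormal e γ y, a⟫ := by
  have hγc := hL.continuous
  -- Points below the graph are pushed up to it along `e`; this extends `V` continuously to all of
  -- `E` without changing it on the closed epigraph.
  set V' : E → ℝ := fun x => V (x + max (γ x - ⟪x, e⟫) 0 • e) with hV'
  have hV'c : Continuous V' := by
    refine hV.comp_continuous (by fun_prop) fun x => ?_
    change γ _ ≤ _
    rw [hγ, inner_add_left, real_inner_smul_left, real_inner_self_eq_norm_sq, he]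
    linarith [le_max_left (γ x - ⟪x, e⟫) 0]
  have heq : ∀ x, γ x ≤ ⟪x, e⟫ → V' x = V x := fun x hx => by
    simp only [V']
    rw [max_eq_right (by linarith), zero_smul, add_zero]
  have hev : ∀ x, γ x < ⟪x, e⟫ → V' =ᶠ[𝓝 x] V := fun x hx => by
    filter_upwards [(isOpen_epigraph hγc).mem_nhds hx] with z hz using heq z (le_of_lt hz)
  have key := integral_epigraph_fderiv_of_continuous hL he hγ hV'c
    (fun x hx hxR => (heq x hx).trans (hR x hx hxR))
    (fun x hx => (hd x hx).congr_of_eventuallyEq (hev x hx))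
    (fun x hx => (hev x hx).fderiv_eq (𝕜 := ℝ) ▸ hM x hx) a
  have hl : ∫ x in {x | γ x < ⟪x, e⟫}, fderiv ℝ V' x a =
      ∫ x in {x | γ x < ⟪x, e⟫}, fderiv ℝ V x a :=
    setIntegral_congr_fun (isOpen_epigraph hγc).measurableSet fun x hx => by
      simp only [(hev x hx).fderiv_eq]
  rw [hl] at key
  rw [key]
  congr 1
  ext y
  rw [heq]
  rw [inner_graphMap he, graphMap, hγ]

end Epigraph


/-! ### Uniqueness of the outward normal. -/

section Normal

variable {n : ℕ} {Ω : Set (Euc n)} {x ν ν' : Euc n}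

/-- If `ν ≠ ν'`, the direction `ν - ν'` makes an acute angle with `ν` and an obtuse one with `ν'`.
Small steps from `x` along it would then be both outside and inside `Ω`. -/
theorem IsOutwardUnitNormal.unique (h : IsOutwardUnitNormal Ω x ν)
    (h' : IsOutwardUnitNormal Ω x ν') : ν = ν' := by
  by_contra hne
  have hv : 0 < ‖ν - ν'‖ := norm_pos_iff.2 (sub_ne_zero.2 hne)
  have hsq : ‖ν - ν'‖ ^ 2 = 2 * (1 - ⟪ν, ν'⟫) := by
    rw [norm_sub_sq_real, h.1, h'.1]
    ring
  set c := 1 - ⟪ν, ν'⟫ with hc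
  have hc0 : 0 < c := by nlinarith
  have h1 : ⟪ν - ν', ν⟫ = c := by
    rw [inner_sub_left, real_inner_self_eq_norm_sq, h.1, real_inner_comm, hc]
    ring
  have h2 : ⟪ν - ν', ν'⟫ = -c := by
    rw [inner_sub_left, real_inner_self_eq_norm_sq, h'.1, hc]
    ring
  -- With this aperture `κ ‖t • (ν - ν')‖` is `t c / 2`, strictly below the inner products `± t c`
  -- in absolute value.
  have hκ : 0 < c / (2 * ‖ν - ν'‖) := by positivity
  have hlim : Tendsto (fun t : ℝ => x + t • (ν - ν')) (𝓝[>] 0) (𝓝 x) := by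
    have : Continuous fun t : ℝ => x + t • (ν - ν') := by fun_prop
    have h0 := this.tendsto 0
    rw [zero_smul, add_zero] at h0
    exact h0.mono_left nhdsWithin_le_nhds
  obtain ⟨t, ⟨ha, hb⟩, ht⟩ := (((hlim.eventually (h.2 _ hκ)).and
    (hlim.eventually (h'.2 _ hκ))).and self_mem_nhdsWithin).exists
  have ht : 0 < t := ht
  have hn : c / (2 * ‖ν - ν'‖) * ‖t • (ν - ν')‖ = t * c / 2 := by
    rw [norm_smul, Real.norm_of_nonneg ht.le]
    field_simp
  simp only [add_sub_cancel_left, hn, real_inner_smul_left, h1, h2] at ha hb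
  have htc : 0 < t * c := by positivity
  exact ha.2 (by linarith) (hb.1 (by linarith))

theorem IsOutwardUnitNormal.outwardNormal_eq (h : IsOutwardUnitNormal Ω x ν) :
    outwardNormal Ω x = ν := by
  have hx : ∃ ν, IsOutwardUnitNormal Ω x ν := ⟨ν, h⟩
  rw [outwardNormal, dif_pos hx]
  exact hx.choose_spec.unique h

theorem norm_outwardNormal_le : ‖outwardNormal Ω x‖ ≤ 1 := by
  rw [outwardNormal]
  split_ifs with hx
  · exact hx.choose_spec.1.le
  · simp

end Normal

/-- In the open set `N`, the set `Ω` is the epigraph of the Lipschitz function `γ` in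
direction `e`. -/
structure IsGraphChart {n : ℕ} (Ω : Set (Euc n)) (e : Euc n) (γ : Euc n → ℝ) (N : Set (Euc n)) :
    Prop where
  norm_eq : ‖e‖ = 1
  lipschitz : ∃ K, LipschitzWith K γ
  invariant : ∀ (x : Euc n) (t : ℝ), γ (x + t • e) = γ x
  isOpen : IsOpen N
  mem_iff : ∀ x ∈ N, (x ∈ Ω ↔ γ x < ⟪x, e⟫)

theorem IsLipschitzDomain.exists_chart {n : ℕ} {Ω : Set (Euc n)} (hΩ : IsLipschitzDomain Ω)
    {x₀ : Euc n} (hx₀ : x₀ ∈ frontier Ω) : ∃ e γ N, x₀ ∈ N ∧ IsGraphChart Ω e γ N := by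
  obtain ⟨e, γ, he, hK, hγ, hev⟩ := hΩ.graph x₀ hx₀
  obtain ⟨N, hN, hNo, hxN⟩ := eventually_nhds_iff.1 hev
  exact ⟨e, γ, N, hxN, he, hK, hγ, hNo, hN⟩

/-! ### Surface measure, normal and divergence theorem in a graph chart. -/

section Surface

variable {n : ℕ} {Ω : Set (Euc n)}

theorem finrank_orthogonal_span_singleton_euc {e : Euc n} (he : ‖e‖ = 1) :
    Module.finrank ℝ (ℝ ∙ e)ᗮ = n - 1 := by
  have h0 : e ≠ 0 := by
    rintro rfl
    simp at he
  have h1 := (ℝ ∙ e).finrank_add_finrank_orthogonal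
  rw [finrank_span_singleton h0, finrank_euclideanSpace_fin] at h1
  omega

/-- The outward unit normal to the epigraph of `γ` in direction `e`. -/
noncomputable def graphUnitNormal (e : Euc n) (γ : Euc n → ℝ) (x : Euc n) : Euc n :=
  ‖graphNormal e γ x‖⁻¹ • graphNormal e γ x

theorem measurable_graphUnitNormal {e : Euc n} {γ : Euc n → ℝ} :
    Measurable (graphUnitNormal e γ) :=
  measurable_graphNormal.norm.inv.smul measurable_graphNormal

namespace IsGraphChart

variable {e : Euc n} {γ : Euc n → ℝ} {N : Set (Euc n)}

theorem mono (h : IsGraphChart Ω e γ N) {N' : Set (Euc n)} (hN : N' ⊆ N) (hN' : IsOpen N') :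
    IsGraphChart Ω e γ N' :=
  ⟨h.norm_eq, h.lipschitz, h.invariant, hN', fun x hx => h.mem_iff x (hN hx)⟩

theorem continuous (h : IsGraphChart Ω e γ N) : Continuous γ :=
  h.lipschitz.choose_spec.continuous

theorem eventuallyEq (h : IsGraphChart Ω e γ N) {x : Euc n} (hx : x ∈ N) :
    ∀ᶠ z in 𝓝 x, (z ∈ Ω ↔ γ z < ⟪z, e⟫) := by
  filter_upwards [h.isOpen.mem_nhds hx] with z hz using h.mem_iff z hz

theorem mem_closure_iff (h : IsGraphChart Ω e γ N) {x : Euc n} (hx : x ∈ N) :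
    x ∈ closure Ω ↔ γ x ≤ ⟪x, e⟫ := by
  rw [mem_closure_iff_frequently, frequently_congr (h.eventuallyEq hx)]
  constructor
  · intro hf
    have : x ∈ closure {x | γ x ≤ ⟪x, e⟫} :=
      mem_closure_iff_frequently.2 (hf.mono fun z hz => le_of_lt hz)
    rwa [(isClosed_epigraph h.continuous).closure_eq] at this
  · intro hle
    have hlim : Tendsto (fun t : ℝ => x + t • e) (𝓝[>] 0) (𝓝 x) := by
      have : Continuous fun t : ℝ => x + t • e := by fun_prop
      have h0 := this.tendsto 0
      rw [zero_smul, add_zero] at h0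
      exact h0.mono_left nhdsWithin_le_nhds
    refine hlim.frequently (Eventually.frequently ?_)
    filter_upwards [self_mem_nhdsWithin] with t (ht : 0 < t)
    rw [h.invariant, inner_add_left, real_inner_smul_left, real_inner_self_eq_norm_sq, h.norm_eq]
    linarith

theorem mem_frontier_iff (h : IsGraphChart Ω e γ N) (hΩ : IsOpen Ω) {x : Euc n} (hx : x ∈ N) :
    x ∈ frontier Ω ↔ γ x = ⟪x, e⟫ := by
  rw [hΩ.frontier_eq, Set.mem_sdiff, h.mem_closure_iff hx, h.mem_iff x hx, not_lt, le_antisymm_iff]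

/-- To first order at `x`, `γ y - ⟪y, e⟫` equals `⟪y - x, graphNormal e γ x⟫`. The remainder is at
most `κ ‖y - x‖` near `x`, and normalizing is harmless as `graphNormal` has norm at least `1`. -/
theorem isOutwardUnitNormal (h : IsGraphChart Ω e γ N) {x : Euc n} (hx : x ∈ N)
    (hγx : γ x = ⟪x, e⟫) (hd : DifferentiableAt ℝ γ x) :
    IsOutwardUnitNormal Ω x (graphUnitNormal e γ x) := by
  have h1 := one_le_norm_graphNormal h.norm_eq h.invariant x
  have hpos : 0 < ‖graphNormal e γ x‖ := by linarith
  refine ⟨?_, fun κ hκ => ?_⟩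
  · rw [graphUnitNormal, norm_smul, norm_inv, norm_norm, inv_mul_cancel₀ hpos.ne']
  filter_upwards [h.eventuallyEq hx, hd.hasFDerivAt.isLittleO.def hκ] with y hy hr
  rw [Real.norm_eq_abs, abs_le] at hr
  have hin : ⟪y - x, graphNormal e γ x⟫ = fderiv ℝ γ x (y - x) - (⟪y, e⟫ - ⟪x, e⟫) := by
    rw [real_inner_comm, inner_graphNormal, inner_sub_right, real_inner_comm, real_inner_comm e x]
  have hκ' : κ * ‖y - x‖ ≤ κ * ‖y - x‖ * ‖graphNormal e γ x‖ :=
    le_mul_of_one_le_right (by positivity) h1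
  rw [hy, graphUnitNormal, inner_smul_right, inv_mul_lt_iff₀ hpos, lt_inv_mul_iff₀ hpos, hin]
  constructor
  · intro hlt
    nlinarith
  · intro hlt
    nlinarith

theorem surfaceMeasure_restrict (h : IsGraphChart Ω e γ N) (hΩ : IsOpen Ω) :
    (surfaceMeasure Ω).restrict N =
      (((volume : Measure (ℝ ∙ e)ᗮ).withDensity
        fun y => ENNReal.ofReal ‖graphNormal e γ y‖).map (graphMap e γ)).restrict N := by
  obtain ⟨K, hK⟩ := h.lipschitz
  rw [← euclideanHausdorffMeasure_restrict_graph hK h.norm_eq h.invariant, surfaceMeasure,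
    finrank_orthogonal_span_singleton_euc h.norm_eq,
    Measure.restrict_restrict h.isOpen.measurableSet,
    Measure.restrict_restrict h.isOpen.measurableSet]
  congr 1
  ext x
  exact and_congr_right fun hx => h.mem_frontier_iff hΩ hx

theorem ae_isOutwardUnitNormal (h : IsGraphChart Ω e γ N) (hΩ : IsOpen Ω) :
    ∀ᵐ x ∂(surfaceMeasure Ω).restrict N,
      IsOutwardUnitNormal Ω x (graphUnitNormal e γ x) := by
  obtain ⟨K, hK⟩ := h.lipschitz
  have hΦ : Measurable (graphMap e γ) := (hK.graphMap h.norm_eq).continuous.measurable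
  have hae : ∀ᵐ x ∂((volume : Measure (ℝ ∙ e)ᗮ).withDensity
      fun y => ENNReal.ofReal ‖graphNormal e γ y‖).map (graphMap e γ),
      DifferentiableAt ℝ γ x ∧ γ x = ⟪x, e⟫ := by
    have hms : MeasurableSet {x | DifferentiableAt ℝ γ x ∧ γ x = ⟪x, e⟫} :=
      (measurableSet_of_differentiableAt ℝ γ).inter
        (measurableSet_eq_fun h.continuous.measurable (by fun_prop))
    rw [ae_map_iff hΦ.aemeasurable hms]
    refine (withDensity_absolutelyContinuous _ _).ae_le ?_
    filter_upwards [ae_orthogonal_differentiableAt hK h.norm_eq h.invariant] with y hy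
    refine ⟨(differentiableAt_add_smul_iff h.invariant).2 hy, ?_⟩
    rw [inner_graphMap h.norm_eq, graphMap, h.invariant]
  rw [h.surfaceMeasure_restrict hΩ]
  filter_upwards [ae_restrict_of_ae hae, ae_restrict_mem h.isOpen.measurableSet] with x hx hxN
  exact h.isOutwardUnitNormal hxN hx.2 hx.1

/-- The density is at most `K + 1`, and the parameters of a bounded piece of the graph are bounded
because projecting to `e^⊥` does not increase norms. -/
theorem surfaceMeasure_lt_top (h : IsGraphChart Ω e γ N) (hΩ : IsOpen Ω) {B : Set (Euc n)}
    (hB : MeasurableSet B) (hBN : B ⊆ N) (hBb : Bornology.IsBounded B) :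
    surfaceMeasure Ω B < ⊤ := by
  obtain ⟨K, hK⟩ := h.lipschitz
  have hΦ : Measurable (graphMap e γ) := (hK.graphMap h.norm_eq).continuous.measurable
  have h1 : surfaceMeasure Ω B = (surfaceMeasure Ω).restrict N B := by
    rw [Measure.restrict_apply hB, inter_eq_left.2 hBN]
  obtain ⟨R, hR⟩ := hBb.subset_closedBall (0 : Euc n)
  rw [h1, h.surfaceMeasure_restrict hΩ, Measure.restrict_apply hB, inter_eq_left.2 hBN,
    Measure.map_apply hΦ hB, withDensity_apply _ (hΦ hB)]
  calc ∫⁻ y in graphMap e γ ⁻¹' B, ENNReal.ofReal ‖graphNormal e γ y‖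
      ≤ ∫⁻ y in graphMap e γ ⁻¹' B, ENNReal.ofReal (K + 1) :=
        lintegral_mono fun y => ENNReal.ofReal_le_ofReal (norm_graphNormal_le hK h.norm_eq _)
    _ ≤ ∫⁻ y in Metric.closedBall (0 : (ℝ ∙ e)ᗮ) R, ENNReal.ofReal (K + 1) := by
        refine lintegral_mono_set fun y hy => ?_
        have h2 := hR hy
        rw [mem_closedBall_zero_iff] at h2 ⊢
        exact (norm_le_norm_orthogonal_add_smul h.norm_eq y _).trans h2
    _ < ⊤ := by
        rw [setLIntegral_const]
        exact ENNReal.mul_lt_top ENNReal.ofReal_lt_top measure_closedBall_lt_top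

/-- The divergence theorem in a chart. -/
theorem integral_fderiv (h : IsGraphChart Ω e γ N) (hΩ : IsOpen Ω) {V : Euc n → ℝ}
    (hV : ContinuousOn V (closure Ω)) (hd : ∀ x ∈ Ω, DifferentiableAt ℝ V x) {M : ℝ}
    (hM : ∀ x ∈ Ω, ‖fderiv ℝ V x‖ ≤ M) {S : Set (Euc n)} (hS : IsCompact S) (hSN : S ⊆ N)
    (hVS : ∀ x, x ∉ S → V x = 0) (a : Euc n) :
    ∫ x in Ω, fderiv ℝ V x a =
      ∫ x, V x * ⟪outwardNormal Ω x, a⟫ ∂surfaceMeasure Ω := by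
  obtain ⟨K, hK⟩ := h.lipschitz
  have hU := isOpen_epigraph (e := e) h.continuous
  have hev : ∀ x, x ∉ S → V =ᶠ[𝓝 x] fun _ => 0 := fun x hx => by
    filter_upwards [hS.isClosed.isOpen_compl.mem_nhds hx] with z hz using hVS z hz
  have hfd : ∀ x, x ∉ S → fderiv ℝ V x = 0 := fun x hx => by
    rw [(hev x hx).fderiv_eq]
    simp
  -- Inside `N` the closed epigraph is `closure Ω`; away from `S`, `V` is locally zero. So `V` is
  -- continuous on the whole closed epigraph although nothing relates it to `Ω` outside `N`.
  have hVc : ContinuousOn V {x | γ x ≤ ⟪x, e⟫} := by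
    intro x hx
    by_cases hxS : x ∈ S
    · have hxN := hSN hxS
      have h1 := hV x ((h.mem_closure_iff hxN).2 hx)
      refine ContinuousWithinAt.mono_of_mem_nhdsWithin h1 ?_
      filter_upwards [self_mem_nhdsWithin, mem_nhdsWithin_of_mem_nhds (h.isOpen.mem_nhds hxN)]
        with z hz hzN using (h.mem_closure_iff hzN).2 hz
    · exact (continuousAt_const.congr (hev x hxS).symm).continuousWithinAt
  obtain ⟨R, hR⟩ := hS.isBounded.subset_closedBall (0 : Euc n)
  have hVR : ∀ x, γ x ≤ ⟪x, e⟫ → R < ‖x‖ → V x = 0 := fun x _ hx => hVS x fun hxS => by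
    have := mem_closedBall_zero_iff.1 (hR hxS)
    linarith
  have key := integral_epigraph_fderiv hK h.norm_eq h.invariant hVc hVR (M := max M 0)
    (fun x hx => by
      by_cases hxS : x ∈ S
      · exact hd x ((h.mem_iff x (hSN hxS)).2 hx)
      · exact (differentiableAt_const 0).congr_of_eventuallyEq (hev x hxS))
    (fun x hx => by
      by_cases hxS : x ∈ S
      · exact (hM x ((h.mem_iff x (hSN hxS)).2 hx)).trans (le_max_left _ _)
      · rw [hfd x hxS, norm_zero]
        exact le_max_right _ _) a
  have hbulk : ∫ x in Ω, fderiv ℝ V x a = ∫ x in {x | γ x < ⟪x, e⟫}, fderiv ℝ V x a := by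
    rw [← integral_indicator hΩ.measurableSet, ← integral_indicator hU.measurableSet]
    congr 1
    ext x
    by_cases hxS : x ∈ S
    · simp only [indicator, h.mem_iff x (hSN hxS)]
      rfl
    · simp [indicator, hfd x hxS]
  have hN0 : ∀ (W : Euc n → ℝ) x, x ∉ N → V x * W x = 0 := fun W x hx => by
    rw [hVS x fun hxS => hx (hSN hxS), zero_mul]
  have hΦ : Measurable (graphMap e γ) := (hK.graphMap h.norm_eq).continuous.measurable
  have hnorm : Measurable fun y : (ℝ ∙ e)ᗮ => ENNReal.ofReal ‖graphNormal e γ y‖ :=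
    (measurable_graphNormal.comp measurable_subtype_coe).norm.ennreal_ofReal
  have hsurf : ∫ x, V x * ⟪outwardNormal Ω x, a⟫ ∂surfaceMeasure Ω =
      ∫ y : (ℝ ∙ e)ᗮ, V (graphMap e γ y) * ⟪graphNormal e γ y, a⟫ := by
    rw [← setIntegral_eq_integral_of_forall_compl_eq_zero (s := N)
      fun x hx => hN0 (fun x => ⟪outwardNormal Ω x, a⟫) x hx]
    have h1 : ∀ᵐ x ∂(surfaceMeasure Ω).restrict N, V x * ⟪outwardNormal Ω x, a⟫ =
        V x * ⟪graphUnitNormal e γ x, a⟫ := by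
      filter_upwards [h.ae_isOutwardUnitNormal hΩ] with x hx
      rw [hx.outwardNormal_eq]
    -- In the parametrization the density `‖graphNormal‖` of the surface measure cancels the
    -- normalization of the unit normal.
    rw [integral_congr_ae h1, h.surfaceMeasure_restrict hΩ,
      setIntegral_eq_integral_of_forall_compl_eq_zero (s := N)
        fun x hx => hN0 (fun x => ⟪graphUnitNormal e γ x, a⟫) x hx,
      integral_map hΦ.aemeasurable, integral_withDensity_eq_integral_toReal_smul hnorm
        (Eventually.of_forall fun _ => ENNReal.ofReal_lt_top)]
    · congr 1
      ext y
      have h2 : graphNormal e γ (graphMap e γ y) = graphNormal e γ y := by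
        rw [graphMap, graphNormal_add_smul h.invariant]
      have h3 := one_le_norm_graphNormal h.norm_eq h.invariant (y : Euc n)
      rw [graphUnitNormal, h2, ENNReal.toReal_ofReal (norm_nonneg _), real_inner_smul_left,
        smul_eq_mul]
      field_simp
    · refine AEStronglyMeasurable.mul ?_ (measurable_graphUnitNormal.inner_const.aestronglyMeasurable)
      rw [← euclideanHausdorffMeasure_restrict_graph hK h.norm_eq h.invariant]
      have hcl : MeasurableSet {x : Euc n | γ x = ⟪x, e⟫} :=
        measurableSet_eq_fun h.continuous.measurable (by fun_prop)
      exact (hVc.mono fun x hx => le_of_eq hx).aestronglyMeasurable hcl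
  rw [hbulk, hsurf, key]

end IsGraphChart

end Surface


/-! ### Divergence theorem on bounded Lipschitz domains. -/

section Domain

/-- Near each point of `closure Ω`, differentiability within the closure provides a continuous,
hence locally bounded, choice of derivative; at points of the open set `Ω` it is the actual one.
Compactness makes the bound uniform. -/
theorem ContDiffOn.exists_bound_fderiv {E F : Type*} [NormedAddCommGroup E] [NormedSpace ℝ E]
    [NormedAddCommGroup F] [NormedSpace ℝ F] {Ω : Set E} (hΩ : IsOpen Ω)
    (hc : IsCompact (closure Ω)) {V : E → F} (hV : ContDiffOn ℝ 1 V (closure Ω)) :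
    ∃ M, ∀ x ∈ Ω, ‖fderiv ℝ V x‖ ≤ M := by
  suffices H : ∃ M, ∀ x ∈ closure Ω ∩ Ω, ‖fderiv ℝ V x‖ ≤ M by
    obtain ⟨M, hM⟩ := H
    exact ⟨M, fun x hx => hM x ⟨subset_closure hx, hx⟩⟩
  refine hc.induction_on (p := fun s => ∃ M, ∀ x ∈ s ∩ Ω, ‖fderiv ℝ V x‖ ≤ M) ⟨0, by simp⟩
    (fun s t hst ⟨M, hM⟩ => ⟨M, fun x hx => hM x ⟨hst hx.1, hx.2⟩⟩) ?_ ?_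
  · rintro s t ⟨M, hM⟩ ⟨M', hM'⟩
    refine ⟨max M M', fun x hx => ?_⟩
    rcases hx.1 with h | h
    · exact (hM x ⟨h, hx.2⟩).trans (le_max_left _ _)
    · exact (hM' x ⟨h, hx.2⟩).trans (le_max_right _ _)
  · intro x hx
    have h1 : ContDiffWithinAt ℝ (0 + 1) V (closure Ω) x := by
      rw [zero_add]
      exact hV x hx
    obtain ⟨u, hu, -, f', hf', hcf'⟩ :=
      (contDiffWithinAt_succ_iff_hasFDerivWithinAt (by simp)).1 h1
    rw [insert_eq_of_mem hx] at hu
    have hb : ∀ᶠ y in 𝓝[u] x, ‖f' y‖ < ‖f' x‖ + 1 :=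
      hcf'.continuousWithinAt.norm.eventually (gt_mem_nhds (lt_add_one _))
    have hb' : ∀ᶠ y in 𝓝[closure Ω] x, y ∈ u ∧ ‖f' y‖ < ‖f' x‖ + 1 :=
      (eventually_mem_set.2 hu).and (nhdsWithin_le_of_mem hu hb)
    obtain ⟨O, hO, hxO, hOu⟩ := mem_nhdsWithin.1 hb'
    refine ⟨O ∩ closure Ω, mem_nhdsWithin.2 ⟨O, hO, hxO, subset_rfl⟩, ‖f' x‖ + 1, fun y hy => ?_⟩
    have hyu := hOu hy.1
    have hun : u ∈ 𝓝 y := by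
      filter_upwards [hO.mem_nhds hy.1.1, hΩ.mem_nhds hy.2] with z hz1 hz2
        using (hOu ⟨hz1, subset_closure hz2⟩).1
    rw [((hf' y hyu.1).hasFDerivAt hun).fderiv]
    exact hyu.2.le

variable {n : ℕ} {Ω : Set (Euc n)}

namespace IsLipschitzDomain

theorem isCompact_closure (hΩ : IsLipschitzDomain Ω) : IsCompact (closure Ω) :=
  hΩ.isBounded.isCompact_closure

theorem isCompact_frontier (hΩ : IsLipschitzDomain Ω) : IsCompact (frontier Ω) :=
  hΩ.isCompact_closure.of_isClosed_subset isClosed_frontier frontier_subset_closure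

/-- A property of sets holds for the boundary if it is local and holds in charts. -/
theorem frontier_induction (hΩ : IsLipschitzDomain Ω) {p : Set (Euc n) → Prop} (he : p ∅)
    (hmono : ∀ ⦃s t⦄, s ⊆ t → p t → p s) (hunion : ∀ ⦃s t⦄, p s → p t → p (s ∪ t))
    (hchart : ∀ e γ N, IsGraphChart Ω e γ N → Bornology.IsBounded N → p N) :
    p (frontier Ω) := by
  refine hΩ.isCompact_frontier.induction_on he hmono hunion fun x hx => ?_
  obtain ⟨e, γ, N, hxN, hN⟩ := hΩ.exists_chart hx
  refine ⟨N ∩ Metric.ball x 1, mem_nhdsWithin_of_mem_nhds (inter_mem (hN.isOpen.mem_nhds hxN)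
    (Metric.ball_mem_nhds x one_pos)), ?_⟩
  exact hchart e γ _ (hN.mono inter_subset_left (hN.isOpen.inter Metric.isOpen_ball))
    (Metric.isBounded_ball.subset inter_subset_right)

theorem surfaceMeasure_restrict_frontier (Ω : Set (Euc n)) :
    (surfaceMeasure Ω).restrict (frontier Ω) = surfaceMeasure Ω := by
  rw [surfaceMeasure, Measure.restrict_restrict isClosed_frontier.measurableSet, inter_self]

theorem isFiniteMeasure_surfaceMeasure (hΩ : IsLipschitzDomain Ω) :
    IsFiniteMeasure (surfaceMeasure Ω) := by
  refine ⟨?_⟩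
  rw [← surfaceMeasure_restrict_frontier, Measure.restrict_apply_univ]
  refine hΩ.frontier_induction (p := fun s => surfaceMeasure Ω s < ⊤) (by simp)
    (fun s t hst ht => (measure_mono hst).trans_lt ht)
    (fun s t hs ht => (measure_union_le _ _).trans_lt (ENNReal.add_lt_top.2 ⟨hs, ht⟩))
    fun e γ N hN hNb => ?_
  exact hN.surfaceMeasure_lt_top hΩ.isOpen hN.isOpen.measurableSet subset_rfl hNb

theorem ae_exists_isOutwardUnitNormal (hΩ : IsLipschitzDomain Ω) :
    ∀ᵐ x ∂surfaceMeasure Ω, ∃ ν, IsOutwardUnitNormal Ω x ν := by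
  rw [← surfaceMeasure_restrict_frontier]
  refine hΩ.frontier_induction
    (p := fun s => ∀ᵐ x ∂(surfaceMeasure Ω).restrict s, ∃ ν, IsOutwardUnitNormal Ω x ν) (by simp)
    (fun s t hst ht => ae_restrict_of_ae_restrict_of_subset hst ht)
    (fun s t hs ht => (ae_restrict_union_iff _ _ _).2 ⟨hs, ht⟩) fun e γ N hN _ => ?_
  filter_upwards [hN.ae_isOutwardUnitNormal hΩ.isOpen] with x hx using ⟨_, hx⟩

theorem ae_mem_regularBoundary (hΩ : IsLipschitzDomain Ω) :
    ∀ᵐ x ∂surfaceMeasure Ω, x ∈ regularBoundary Ω := by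
  have h1 : ∀ᵐ x ∂surfaceMeasure Ω, x ∈ frontier Ω :=
    ae_restrict_mem isClosed_frontier.measurableSet
  filter_upwards [h1, hΩ.ae_exists_isOutwardUnitNormal] with x hx hν using ⟨hx, hν⟩

theorem aemeasurable_outwardNormal (hΩ : IsLipschitzDomain Ω) :
    AEMeasurable (outwardNormal Ω) (surfaceMeasure Ω) := by
  rw [← surfaceMeasure_restrict_frontier]
  refine hΩ.frontier_induction
    (p := fun s => AEMeasurable (outwardNormal Ω) ((surfaceMeasure Ω).restrict s)) (by simp)
    (fun s t hst ht => ht.mono_measure (Measure.restrict_mono hst le_rfl))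
    (fun s t hs ht => aemeasurable_union_iff.2 ⟨hs, ht⟩) fun e γ N hN _ => ?_
  refine measurable_graphUnitNormal.aemeasurable.congr (f := graphUnitNormal e γ) ?_
  filter_upwards [hN.ae_isOutwardUnitNormal hΩ.isOpen] with x hx using hx.outwardNormal_eq.symm

/-- Locally, a function supported in the interior or in a chart satisfies the divergence
theorem. -/
theorem exists_isOpen_integral_fderiv (hΩ : IsLipschitzDomain Ω) {x₀ : Euc n}
    (hx₀ : x₀ ∈ closure Ω) : ∃ N, IsOpen N ∧ x₀ ∈ N ∧ Bornology.IsBounded N ∧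
      ∀ (V : Euc n → ℝ) (S : Set (Euc n)), ContDiffOn ℝ 1 V (closure Ω) → IsCompact S →
        S ⊆ N → (∀ x, x ∉ S → V x = 0) → ∀ a, ∫ x in Ω, fderiv ℝ V x a =
          ∫ x, V x * ⟪outwardNormal Ω x, a⟫ ∂surfaceMeasure Ω := by
  have hd : ∀ V : Euc n → ℝ, ContDiffOn ℝ 1 V (closure Ω) → ∀ x ∈ Ω, ContDiffAt ℝ 1 V x :=
    fun V hV x hx => hV.contDiffAt (mem_of_superset (hΩ.isOpen.mem_nhds hx) subset_closure)
  by_cases hx : x₀ ∈ Ω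
  · refine ⟨Ω, hΩ.isOpen, hx, hΩ.isBounded, fun V S hV hS hSΩ hVS a => ?_⟩
    have hV1 : ContDiff ℝ 1 V := by
      rw [contDiff_iff_contDiffAt]
      intro x
      by_cases hxS : x ∈ S
      · exact hd V hV x (hSΩ hxS)
      · refine (contDiffAt_const (c := (0 : ℝ))).congr_of_eventuallyEq ?_
        filter_upwards [hS.isClosed.isOpen_compl.mem_nhds hxS] with z hz using hVS z hz
    have hVc : HasCompactSupport V := HasCompactSupport.intro hS hVS
    have hfc : HasCompactSupport fun x => fderiv ℝ V x a := hVc.fderiv_apply (𝕜 := ℝ) a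
    have hfS : ∀ x, x ∉ Ω → fderiv ℝ V x a = 0 := fun x hx => by
      have : V =ᶠ[𝓝 x] fun _ => 0 := by
        filter_upwards [hS.isClosed.isOpen_compl.mem_nhds fun h => hx (hSΩ h)] with z hz
          using hVS z hz
      rw [this.fderiv_eq]
      simp
    have hcf : Continuous fun x => fderiv ℝ V x a :=
      (hV1.continuous_fderiv one_ne_zero).clm_apply continuous_const
    -- For support inside `Ω` both sides vanish: the left by integration by parts against the
    -- constant `1`, the right because `V = 0` on the frontier.
    have h1 := integral_mul_fderiv_eq_neg_fderiv_mul_of_integrable (μ := (volume : Measure (Euc n)))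
      (f := fun _ => (1 : ℝ)) (g := V) (v := a) (by simp)
      (by simpa using hcf.integrable_of_hasCompactSupport hfc)
      (by simpa using hV1.continuous.integrable_of_hasCompactSupport hVc)
      (by simp) (fun x _ => (hV1.differentiable one_ne_zero) x)
    simp only [one_mul, fderiv_fun_const, Pi.zero_apply, _root_.zero_apply, zero_mul,
      integral_zero, neg_zero] at h1
    rw [setIntegral_eq_integral_of_forall_compl_eq_zero hfS, h1, ← surfaceMeasure_restrict_frontier]
    symm
    refine setIntegral_eq_zero_of_forall_eq_zero fun x hx => ?_
    rw [hVS x fun h => ?_, zero_mul]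
    rw [hΩ.isOpen.frontier_eq] at hx
    exact hx.2 (hSΩ h)
  · have hxf : x₀ ∈ frontier Ω := by
      rw [hΩ.isOpen.frontier_eq]
      exact ⟨hx₀, hx⟩
    obtain ⟨e, γ, N, hxN, hN⟩ := hΩ.exists_chart hxf
    have hN' := hN.mono inter_subset_left (hN.isOpen.inter (Metric.isOpen_ball (x := x₀) (ε := 1)))
    refine ⟨_, hN'.isOpen, ⟨hxN, Metric.mem_ball_self one_pos⟩,
      Metric.isBounded_ball.subset inter_subset_right, fun V S hV hS hSN hVS a => ?_⟩
    obtain ⟨M, hM⟩ := hV.exists_bound_fderiv hΩ.isOpen hΩ.isCompact_closure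
    exact hN'.integral_fderiv hΩ.isOpen hV.continuousOn
      (fun x hx => (hd V hV x hx).differentiableAt one_ne_zero) hM hS hSN hVS a

theorem integrableOn_fderiv (hΩ : IsLipschitzDomain Ω) {V : Euc n → ℝ}
    (hV : ContDiffOn ℝ 1 V (closure Ω)) (a : Euc n) :
    IntegrableOn (fun x => fderiv ℝ V x a) Ω := by
  obtain ⟨M, hM⟩ := hV.exists_bound_fderiv hΩ.isOpen hΩ.isCompact_closure
  have hfin : volume Ω < ⊤ := hΩ.isBounded.measure_lt_top
  refine Integrable.mono' (g := fun _ => M * ‖a‖) (integrableOn_const hfin.ne)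
    (measurable_fderiv_apply_const ℝ V a).aestronglyMeasurable ?_
  rw [ae_restrict_iff' hΩ.isOpen.measurableSet]
  exact Eventually.of_forall fun x hx => (fderiv ℝ V x).le_of_opNorm_le (hM x hx) a

theorem integrable_mul_inner_outwardNormal (hΩ : IsLipschitzDomain Ω) {V : Euc n → ℝ}
    (hV : ContinuousOn V (closure Ω)) (a : Euc n) :
    Integrable (fun x => V x * ⟪outwardNormal Ω x, a⟫) (surfaceMeasure Ω) := by
  have := hΩ.isFiniteMeasure_surfaceMeasure
  obtain ⟨C, hC⟩ := hΩ.isCompact_closure.exists_bound_of_continuousOn hV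
  rw [← surfaceMeasure_restrict_frontier]
  refine Integrable.mono' (g := fun _ => C * ‖a‖) (integrable_const _) ?_ ?_
  · refine AEStronglyMeasurable.mul ?_ ?_
    · exact (hV.mono frontier_subset_closure).aestronglyMeasurable isClosed_frontier.measurableSet
    · rw [surfaceMeasure_restrict_frontier]
      exact (hΩ.aemeasurable_outwardNormal.inner_const).aestronglyMeasurable
  · filter_upwards [ae_restrict_mem isClosed_frontier.measurableSet] with x hx
    rw [norm_mul]
    have h1 := hC x (frontier_subset_closure hx)
    have h2 := norm_inner_le_norm (𝕜 := ℝ) (outwardNormal Ω x) a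
    have h3 := mul_le_mul_of_nonneg_right (norm_outwardNormal_le (Ω := Ω) (x := x)) (norm_nonneg a)
    rw [one_mul] at h3
    exact mul_le_mul h1 (h2.trans h3) (norm_nonneg _) ((norm_nonneg _).trans h1)

/-- The divergence theorem on bounded Lipschitz domains. -/
theorem integral_fderiv (hΩ : IsLipschitzDomain Ω) {V : Euc n → ℝ}
    (hV : ContDiffOn ℝ 1 V (closure Ω)) (a : Euc n) :
    ∫ x in Ω, fderiv ℝ V x a = ∫ x, V x * ⟪outwardNormal Ω x, a⟫ ∂surfaceMeasure Ω := by
  choose! N hNo hxN hNb hN using fun x hx => hΩ.exists_isOpen_integral_fderiv (x₀ := x) hx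
  obtain ⟨t, htΩ, ht⟩ := hΩ.isCompact_closure.elim_nhds_subcover N
    fun x hx => (hNo x hx).mem_nhds (hxN x hx)
  obtain ⟨ψ, hψ⟩ := SmoothPartitionOfUnity.exists_isSubordinate
    (modelWithCornersSelf ℝ (Euc n)) isClosed_closure
    (fun i : t => N i) (fun i => hNo i (htΩ i i.2)) (s := closure Ω)
    fun x hx => by
      obtain ⟨i, hi, hxi⟩ := mem_iUnion₂.1 (ht hx)
      exact mem_iUnion.2 ⟨⟨i, hi⟩, hxi⟩
  have hψs : ∀ i, ContDiff ℝ 1 (ψ i) := fun i =>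
    ((ψ i).contMDiff.contDiff).of_le (by exact_mod_cast le_top)
  have hsum : ∀ x ∈ closure Ω, ∑ i, ψ i x = 1 := fun x hx => by
    rw [← finsum_eq_sum_of_fintype]
    exact ψ.sum_eq_one hx
  have hC : ∀ i, ContDiffOn ℝ 1 (fun x => ψ i x * V x) (closure Ω) := fun i =>
    (hψs i).contDiffOn.mul hV
  have hi : ∀ i : t, ∫ x in Ω, fderiv ℝ (fun x => ψ i x * V x) x a =
      ∫ x, ψ i x * V x * ⟪outwardNormal Ω x, a⟫ ∂surfaceMeasure Ω := fun i => by
    refine hN i (htΩ i i.2) _ (tsupport (ψ i)) (hC i) ?_ (hψ i) (fun x hx => ?_) a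
    · exact Metric.isCompact_of_isClosed_isBounded (isClosed_tsupport _)
        ((hNb i (htΩ i i.2)).subset (hψ i))
    · rw [image_eq_zero_of_notMem_tsupport hx, zero_mul]
  -- The partition sums to `1` only on `closure Ω`, so the derivatives are compared at points of
  -- `Ω`, where this holds in a neighbourhood.
  have hd : ∀ x ∈ Ω, fderiv ℝ V x a = ∑ i, fderiv ℝ (fun x => ψ i x * V x) x a := fun x hx => by
    have hev : V =ᶠ[𝓝 x] fun z => ∑ i, ψ i z * V z := by
      filter_upwards [hΩ.isOpen.mem_nhds hx] with z hz
      rw [← Finset.sum_mul, hsum z (subset_closure hz), one_mul]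
    rw [hev.fderiv_eq, fderiv_fun_sum, sum_apply]
    exact fun i _ => ((hC i).contDiffAt (mem_of_superset (hΩ.isOpen.mem_nhds hx)
      subset_closure)).differentiableAt one_ne_zero
  rw [setIntegral_congr_fun hΩ.isOpen.measurableSet hd,
    integral_finsetSum _ fun i _ => hΩ.integrableOn_fderiv (hC i) a, Finset.sum_congr rfl
    fun i _ => hi i, ← integral_finsetSum _ fun i _ =>
      hΩ.integrable_mul_inner_outwardNormal (hC i).continuousOn a, ← surfaceMeasure_restrict_frontier]
  refine setIntegral_congr_fun isClosed_frontier.measurableSet fun x hx => ?_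
  change ∑ i, ψ i x * V x * _ = _
  rw [← Finset.sum_mul, ← Finset.sum_mul, hsum x (frontier_subset_closure hx), one_mul]

end IsLipschitzDomain

end Domain


/-! ### Superposition operators with `p`-growth. -/

section Nemytskii

/-- Nothing is known of `q` off `T × Y`. Replacing it there by zero gives a Borel function on the
product, which can be composed with `x ↦ (x, v x)`. -/
theorem ContinuousOn.aestronglyMeasurable_comp_prodMk {X Y Z : Type*} [TopologicalSpace X]
    [MeasurableSpace X] [BorelSpace X] [SecondCountableTopology X] [TopologicalSpace Y]
    [MeasurableSpace Y] [BorelSpace Y] [SecondCountableTopology Y]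
    [TopologicalSpace.PseudoMetrizableSpace Y]
    [TopologicalSpace Z] [TopologicalSpace.PseudoMetrizableSpace Z] [SecondCountableTopology Z]
    [MeasurableSpace Z] [BorelSpace Z] [Zero Z]
    {μ : Measure X} {T : Set X} (hT : MeasurableSet T) {q : X × Y → Z}
    (hq : ContinuousOn q (T ×ˢ univ)) {v : X → Y} (hv : AEStronglyMeasurable v (μ.restrict T)) :
    AEStronglyMeasurable (fun x => q (x, v x)) (μ.restrict T) := by
  classical
  have hTm : MeasurableSet (T ×ˢ (univ : Set Y)) := hT.prod MeasurableSet.univ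
  have h1 : Measurable ((T ×ˢ (univ : Set Y)).piecewise q fun _ => 0) :=
    hq.measurable_piecewise continuousOn_const hTm
  have h2 : AEMeasurable (fun x => (T ×ˢ (univ : Set Y)).piecewise q (fun _ => 0) (x, v x))
      (μ.restrict T) := h1.comp_aemeasurable (aemeasurable_id.prodMk hv.aemeasurable)
  refine (h2.congr ?_).aestronglyMeasurable
  filter_upwards [ae_restrict_mem hT] with x hx
  rw [piecewise_eq_of_mem]
  exact ⟨hx, mem_univ _⟩

variable {X Y : Type*} [MeasurableSpace X] {μ : Measure X} [NormedAddCommGroup Y] {p C : ℝ}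

theorem integrable_of_growth [IsFiniteMeasure μ] (hp : 0 < p) {f : X → ℝ}
    (hf : AEStronglyMeasurable f μ) {v : X → Y} (hv : MemLp v (ENNReal.ofReal p) μ)
    (hfv : ∀ᵐ x ∂μ, |f x| ≤ C * (1 + ‖v x‖ ^ p)) : Integrable f μ := by
  have h1 := hv.integrable_norm_rpow (by simpa using hp) ENNReal.ofReal_ne_top
  rw [ENNReal.toReal_ofReal hp.le] at h1
  exact (((integrable_const (1 : ℝ)).add h1).const_mul C).mono' hf hfv

theorem norm_rpow_le_two_rpow_mul (hp : 0 ≤ p) (v w : Y) :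
    ‖w‖ ^ p ≤ 2 ^ p * (‖v‖ ^ p + ‖w - v‖ ^ p) := by
  have h1 : ‖w‖ ≤ 2 * max ‖v‖ ‖w - v‖ := by
    have := norm_add_le v (w - v)
    rw [add_sub_cancel] at this
    linarith [le_max_left ‖v‖ ‖w - v‖, le_max_right ‖v‖ ‖w - v‖]
  calc ‖w‖ ^ p ≤ (2 * max ‖v‖ ‖w - v‖) ^ p := Real.rpow_le_rpow (norm_nonneg _) h1 hp
    _ = 2 ^ p * max ‖v‖ ‖w - v‖ ^ p := Real.mul_rpow (by norm_num) (by positivity)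
    _ ≤ _ := by
      gcongr
      rcases max_cases ‖v‖ ‖w - v‖ with h | h <;> rw [h.1]
      · exact le_add_of_nonneg_right (by positivity)
      · exact le_add_of_nonneg_left (by positivity)

/-- Used with `r = q x (w x)` and `s = q x (v x)`. The minimum is dominated by a function of `v`
alone, so dominated convergence applies to it; the other term tends to zero in `L¹` when `w → v` in
`L^p`. No common majorant of the sequence is needed. -/
theorem enorm_sub_le_min_add (hp : 0 ≤ p) (hC : 0 ≤ C) {r s : ℝ} {v w : Y}
    (hr : |r| ≤ C * (1 + ‖w‖ ^ p)) (hs : |s| ≤ C * (1 + ‖v‖ ^ p)) :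
    ‖r - s‖ₑ ≤ min ‖r - s‖ₑ (ENNReal.ofReal (C * (2 + (2 ^ p + 1) * ‖v‖ ^ p))) +
      ENNReal.ofReal (C * 2 ^ p) * ‖w - v‖ₑ ^ p := by
  rcases le_total ‖r - s‖ₑ (ENNReal.ofReal (C * (2 + (2 ^ p + 1) * ‖v‖ ^ p))) with h | h
  · rw [min_eq_left h]
    exact le_self_add
  · rw [min_eq_right h, ← ofReal_norm (w - v), ENNReal.ofReal_rpow_of_nonneg (norm_nonneg _) hp,
      ← ENNReal.ofReal_mul (by positivity), ← ENNReal.ofReal_add (by positivity) (by positivity),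
      ← ofReal_norm (r - s)]
    apply ENNReal.ofReal_le_ofReal
    have h1 := mul_le_mul_of_nonneg_left (norm_rpow_le_two_rpow_mul hp v w) hC
    have h2 := abs_sub r s
    rw [Real.norm_eq_abs]
    linarith

/-- Continuity of integral functionals with `p`-growth along sequences converging in `L^p`. -/
theorem tendsto_integral_of_growth [IsFiniteMeasure μ] (hp : 0 < p) {q : X → Y → ℝ}
    (hq : ∀ᵐ x ∂μ, Continuous (q x)) (hC : ∀ᵐ x ∂μ, ∀ y, |q x y| ≤ C * (1 + ‖y‖ ^ p))
    (hm : ∀ v : X → Y, AEStronglyMeasurable v μ → AEStronglyMeasurable (fun x => q x (v x)) μ)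
    {v : X → Y} (hv : MemLp v (ENNReal.ofReal p) μ) {w : ℕ → X → Y}
    (hw : ∀ k, AEStronglyMeasurable (w k) μ)
    (hlim : Tendsto (fun k => eLpNorm (w k - v) (ENNReal.ofReal p) μ) atTop (𝓝 0)) :
    Tendsto (fun k => ∫ x, q x (w k x) ∂μ) atTop (𝓝 (∫ x, q x (v x) ∂μ)) := by
  have hp0 : ENNReal.ofReal p ≠ 0 := by simpa using hp
  have hC' : ∀ᵐ x ∂μ, ∀ y, |q x y| ≤ |C| * (1 + ‖y‖ ^ p) := by
    filter_upwards [hC] with x hx y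
    exact (hx y).trans (mul_le_mul_of_nonneg_right (le_abs_self C) (by positivity))
  -- It suffices to treat a further subsequence of each subsequence, and one can be chosen to
  -- converge almost everywhere.
  refine tendsto_of_subseq_tendsto fun ns hns => ?_
  have hlim' := hlim.comp hns
  obtain ⟨ms, hms, hae⟩ := (tendstoInMeasure_of_tendsto_eLpNorm hp0 (fun k => hw (ns k))
    hv.aestronglyMeasurable hlim').exists_seq_tendsto_ae
  have hlim'' := hlim'.comp hms.tendsto_atTop
  refine ⟨ms, tendsto_integral_of_L1 _ (hm v hv.aestronglyMeasurable) ?_ ?_⟩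
  · filter_upwards [hlim''.eventually (gt_mem_nhds one_pos)] with k hk
    have h1 : MemLp (w (ns (ms k)) - v) (ENNReal.ofReal p) μ :=
      ⟨(hw _).sub hv.aestronglyMeasurable, hk.trans ENNReal.one_lt_top⟩
    have h2 : MemLp (w (ns (ms k))) (ENNReal.ofReal p) μ := by
      have := h1.add hv
      rwa [sub_add_cancel] at this
    refine integrable_of_growth (C := |C|) hp (hm _ (hw _)) h2 ?_
    filter_upwards [hC'] with x hx using hx _
  · have hv' := hv.integrable_norm_rpow hp0 ENNReal.ofReal_ne_top
    rw [ENNReal.toReal_ofReal hp.le] at hv'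
    set A : X → ℝ := fun x => |C| * (2 + (2 ^ p + 1) * ‖v x‖ ^ p) with hA
    have hAint : Integrable A μ := ((integrable_const (2 : ℝ)).add (hv'.const_mul _)).const_mul _
    have hqv := hm v hv.aestronglyMeasurable
    have lim1 : Tendsto (fun k => ∫⁻ x, min ‖q x (w (ns (ms k)) x) - q x (v x)‖ₑ
        (ENNReal.ofReal (A x)) ∂μ) atTop (𝓝 0) := by
      have := tendsto_lintegral_of_dominated_convergence' (μ := μ)
        (F := fun k x => min ‖q x (w (ns (ms k)) x) - q x (v x)‖ₑ (ENNReal.ofReal (A x)))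
        (f := fun _ => 0) (fun x => ENNReal.ofReal (A x))
        (fun k => ((hm _ (hw _)).sub hqv).enorm.min hAint.aemeasurable.ennreal_ofReal)
        (fun k => Eventually.of_forall fun x => min_le_right _ _)
        hAint.lintegral_lt_top.ne ?_
      · simpa using this
      · filter_upwards [hq, hae] with x hx hxk
        have h1 : Tendsto (fun k => q x (w (ns (ms k)) x) - q x (v x)) atTop (𝓝 0) := by
          have := ((hx.tendsto _).comp hxk).sub_const (q x (v x))
          rwa [sub_self] at this
        have h2 := h1.enorm
        rw [enorm_zero] at h2
        exact tendsto_of_tendsto_of_tendsto_of_le_of_le tendsto_const_nhds h2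
          (fun _ => zero_le) (fun _ => min_le_left _ _)
    have lim2 : Tendsto (fun k => ENNReal.ofReal (|C| * 2 ^ p) *
        ∫⁻ x, ‖w (ns (ms k)) x - v x‖ₑ ^ p ∂μ) atTop (𝓝 0) := by
      have h1 : ∀ k, ∫⁻ x, ‖w (ns (ms k)) x - v x‖ₑ ^ p ∂μ =
          eLpNorm (w (ns (ms k)) - v) (ENNReal.ofReal p) μ ^ p := fun k => by
        rw [eLpNorm_eq_lintegral_rpow_enorm_toReal hp0 ENNReal.ofReal_ne_top,
          ENNReal.toReal_ofReal hp.le, ← ENNReal.rpow_mul, one_div, inv_mul_cancel₀ hp.ne',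
          ENNReal.rpow_one]
        rfl
      simp only [h1]
      have h2 := ENNReal.Tendsto.const_mul (a := ENNReal.ofReal (|C| * 2 ^ p))
        (hlim''.ennrpow_const p) (Or.inr ENNReal.ofReal_ne_top)
      rwa [ENNReal.zero_rpow_of_pos hp, mul_zero] at h2
    have lim3 := lim1.add lim2
    rw [add_zero] at lim3
    refine tendsto_of_tendsto_of_tendsto_of_le_of_le tendsto_const_nhds lim3
      (fun _ => zero_le) (fun k => ?_)
    have hmin : AEMeasurable (fun x => min ‖q x (w (ns (ms k)) x) - q x (v x)‖ₑ
        (ENNReal.ofReal (A x))) μ :=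
      ((hm _ (hw _)).sub hqv).enorm.min hAint.aemeasurable.ennreal_ofReal
    rw [← lintegral_const_mul' _ _ ENNReal.ofReal_ne_top, ← lintegral_add_left' hmin]
    refine lintegral_mono_ae ?_
    filter_upwards [hC'] with x hx
    exact enorm_sub_le_min_add hp.le (abs_nonneg C) (hx _) (hx _)

theorem tendsto_eLpNorm_prodMk_sub {Z : Type*} [NormedAddCommGroup Z] {r : ℝ≥0∞} (hr : 1 ≤ r)
    {v : X → Y} {v' : X → Z} {w : ℕ → X → Y} {w' : ℕ → X → Z} (hv : AEStronglyMeasurable v μ)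
    (hv' : AEStronglyMeasurable v' μ) (hw : ∀ k, AEStronglyMeasurable (w k) μ)
    (hw' : ∀ k, AEStronglyMeasurable (w' k) μ)
    (h : Tendsto (fun k => eLpNorm (fun x => w k x - v x) r μ) atTop (𝓝 0))
    (h' : Tendsto (fun k => eLpNorm (fun x => w' k x - v' x) r μ) atTop (𝓝 0)) :
    Tendsto (fun k => eLpNorm ((fun x => (w k x, w' k x)) - fun x => (v x, v' x)) r μ)
      atTop (𝓝 0) := by
  have h1 := h.add h'
  rw [add_zero] at h1
  refine tendsto_of_tendsto_of_tendsto_of_le_of_le tendsto_const_nhds h1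
    (fun _ => zero_le) (fun k => ?_)
  calc _ ≤ eLpNorm ((fun x => ‖w k x - v x‖) + fun x => ‖w' k x - v' x‖) r μ := by
        refine eLpNorm_mono_real fun x => ?_
        simp only [Pi.sub_apply, Pi.add_apply, Prod.mk_sub_mk, Prod.norm_mk]
        exact max_le_add_of_nonneg (norm_nonneg _) (norm_nonneg _)
    _ ≤ _ := eLpNorm_add_le ((hw k).sub hv).norm ((hw' k).sub hv').norm hr
    _ = _ := by
        rw [eLpNorm_norm (fun x => w k x - v x), eLpNorm_norm (fun x => w' k x - v' x)]

end Nemytskii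


/-! ### The fields in `Φ_p`: chain rule, continuity and growth. -/

namespace VariationalProblem

variable {n m : ℕ} (P : VariationalProblem n m)

section Field

variable {P} {φ : Euc n × Euc m → Euc n}

theorem isOpen_cylinder : IsOpen (P.Ω ×ˢ (univ : Set (Euc m))) :=
  P.lipschitz.isOpen.prod isOpen_univ

theorem cylinder_mem_nhds {x : Euc n} (hx : x ∈ P.Ω) (y : Euc m) :
    closure P.Ω ×ˢ (univ : Set (Euc m)) ∈ 𝓝 (x, y) :=
  mem_of_superset (isOpen_cylinder.mem_nhds ⟨hx, mem_univ y⟩) (prod_mono subset_closure subset_rfl)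

theorem dφ_eq_fderiv {x : Euc n} (hx : x ∈ P.Ω) (y : Euc m) :
    P.dφ φ x y = fderiv ℝ φ (x, y) :=
  fderivWithin_of_mem_nhds (cylinder_mem_nhds hx y)

theorem MemΦ.contDiffOn_comp (hφ : P.MemΦ φ) {s : Euc n → Euc m} (hs : ContDiff ℝ ∞ s)
    (i : Fin n) : ContDiffOn ℝ 1 (fun x => φ (x, s x) i) (closure P.Ω) := by
  have h1 : ContDiffOn ℝ 1 (fun x => φ (x, s x)) (closure P.Ω) :=
    hφ.contDiffOn.comp (contDiff_id.prodMk (hs.of_le (by exact_mod_cast le_top))).contDiffOn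
      fun x hx => ⟨hx, mem_univ _⟩
  exact (EuclideanSpace.proj (𝕜 := ℝ) i).contDiff.comp_contDiffOn h1

theorem MemΦ.totalDiv_comp (hφ : P.MemΦ φ) {s : Euc n → Euc m} (hs : ContDiff ℝ ∞ s)
    {x : Euc n} (hx : x ∈ P.Ω) :
    P.totalDiv φ x (s x) (fderiv ℝ s x) =
      ∑ i, fderiv ℝ (fun x => φ (x, s x) i) x (EuclideanSpace.single i 1) := by
  have hD : HasFDerivAt φ (P.dφ φ x (s x)) (x, s x) := by
    rw [dφ_eq_fderiv hx]
    exact ((hφ.contDiffOn.contDiffAt (cylinder_mem_nhds hx _)).differentiableAt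
      one_ne_zero).hasFDerivAt
  have hs' : HasFDerivAt s (fderiv ℝ s x) x := (hs.differentiable (by simp) x).hasFDerivAt
  have hcomp : HasFDerivAt (fun x => φ (x, s x)) _ x :=
    HasFDerivAt.comp x hD ((hasFDerivAt_id x).prodMk hs')
  rw [totalDiv, ← Finset.sum_add_distrib]
  refine Finset.sum_congr rfl fun i _ => ?_
  have hi := ((EuclideanSpace.proj (𝕜 := ℝ) i).hasFDerivAt.comp x hcomp).fderiv
  have hfun : (fun x => φ (x, s x) i) =
      (EuclideanSpace.proj (𝕜 := ℝ) i) ∘ fun x => φ (x, s x) := rfl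
  rw [hfun, hi]
  set v := fderiv ℝ s x (EuclideanSpace.single i 1) with hv
  -- Expanding `v = ∂ᵢs` in the standard basis turns the `y`-part of the derivative into the sum
  -- over `j` in `totalDiv`.
  have hsum : (0, v) = ∑ j, v j • ((0 : Euc n), EuclideanSpace.single j (1 : ℝ)) := by
    ext j
    · simp [Prod.fst_sum]
    · simp [Prod.snd_sum, Pi.single_apply]
  have hsplit : ((EuclideanSpace.single i (1 : ℝ) : Euc n), v) =
      (EuclideanSpace.single i 1, 0) + (0, v) := by simp
  change _ = (P.dφ φ x (s x) (EuclideanSpace.single i 1, v)) i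
  rw [hsplit, map_add, hsum, map_sum]
  simp only [map_smul, PiLp.add_apply, WithLp.ofLp_sum, Finset.sum_apply, PiLp.smul_apply,
    smul_eq_mul, partialX, partialY, matEntry]
  congr 1
  exact Finset.sum_congr rfl fun j _ => mul_comm _ _

/-- The divergence theorem for the composition of a field with a smooth map. -/
theorem MemΦ.integral_totalDiv_of_contDiff (hφ : P.MemΦ φ) {s : Euc n → Euc m}
    (hs : ContDiff ℝ ∞ s) :
    ∫ x in P.Ω, P.totalDiv φ x (s x) (fderiv ℝ s x) =
      ∫ x, ⟪φ (x, s x), outwardNormal P.Ω x⟫ ∂surfaceMeasure P.Ω := by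
  rw [setIntegral_congr_fun P.lipschitz.isOpen.measurableSet fun x hx => hφ.totalDiv_comp hs hx,
    integral_finsetSum _ fun i _ =>
      P.lipschitz.integrableOn_fderiv (hφ.contDiffOn_comp hs i) _,
    Finset.sum_congr rfl fun i _ => P.lipschitz.integral_fderiv (hφ.contDiffOn_comp hs i) _,
    ← integral_finsetSum _ fun i _ => P.lipschitz.integrable_mul_inner_outwardNormal
      (hφ.contDiffOn_comp hs i).continuousOn _]
  congr 1
  ext x
  simp [PiLp.inner_apply, mul_comm]

theorem MemΦ.continuousOn_dφ (hφ : P.MemΦ φ) :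
    ContinuousOn (fun q : Euc n × Euc m => P.dφ φ q.1 q.2) (P.Ω ×ˢ univ) := by
  have h1 : ContinuousOn (fderiv ℝ φ) (P.Ω ×ˢ univ) :=
    (hφ.contDiffOn.mono (prod_mono subset_closure subset_rfl)).continuousOn_fderiv_of_isOpen
      isOpen_cylinder le_rfl
  exact h1.congr fun q hq => dφ_eq_fderiv hq.1 q.2

theorem MemΦ.continuousOn_totalDiv (hφ : P.MemΦ φ) :
    ContinuousOn (fun q : Euc n × Euc m × Grad n m => P.totalDiv φ q.1 q.2.1 q.2.2)
      (P.Ω ×ˢ univ) := by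
  have h1 : ContinuousOn (fun q : Euc n × Euc m × Grad n m => P.dφ φ q.1 q.2.1) (P.Ω ×ˢ univ) :=
    hφ.continuousOn_dφ.comp (f := fun q : Euc n × Euc m × Grad n m => (q.1, q.2.1))
      (by fun_prop) fun q hq => ⟨hq.1, mem_univ _⟩
  have h2 : ∀ (v : Euc n × Euc m) (i : Fin n), ContinuousOn
      (fun q : Euc n × Euc m × Grad n m => P.dφ φ q.1 q.2.1 v i) (P.Ω ×ˢ univ) := fun v i =>
    (EuclideanSpace.proj (𝕜 := ℝ) i).continuous.comp_continuousOn (h1.clm_apply continuousOn_const)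
  have h3 : ∀ (j : Fin m) (i : Fin n), Continuous
      (fun q : Euc n × Euc m × Grad n m => matEntry q.2.2 j i) := fun j i =>
    (EuclideanSpace.proj (𝕜 := ℝ) j).continuous.comp (by fun_prop)
  exact (continuousOn_finsetSum _ fun i _ => h2 _ i).add (continuousOn_finsetSum _ fun i _ =>
    continuousOn_finsetSum _ fun j _ => (h2 _ i).mul (h3 j i).continuousOn)

theorem abs_matEntry_le (z : Grad n m) (j : Fin m) (i : Fin n) : |matEntry z j i| ≤ ‖z‖ := by
  have h1 := PiLp.norm_apply_le (z (EuclideanSpace.single i 1)) j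
  have h2 := z.le_opNorm (EuclideanSpace.single i 1)
  rw [PiLp.norm_single, norm_one, mul_one] at h2
  exact h1.trans h2

/-- The exponent `p - 1` in the bound on `∂φ/∂y` is what compensates the factor `z`: the product is
at most a multiple of `N + N ^ p`, where `N` is the norm of the pair, and `N ≤ 1 + N ^ p`. -/
theorem MemΦ.totalDiv_growth (hφ : P.MemΦ φ) : ∃ C : ℝ, ∀ x ∈ closure P.Ω,
    ∀ q : Euc m × Grad n m, |P.totalDiv φ x q.1 q.2| ≤ C * (1 + ‖q‖ ^ P.p) := by
  obtain ⟨C₁, hC₁⟩ := hφ.growth_x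
  obtain ⟨C₂, hC₂⟩ := hφ.growth_y
  have hp := P.one_lt_p
  refine ⟨|C₁| + 2 * |C₂|, fun x hx q => ?_⟩
  set N := ‖q‖ with hN
  have hN0 : 0 ≤ N := norm_nonneg _
  have hy : ‖q.1‖ ≤ N := norm_fst_le q
  have hz : ‖q.2‖ ≤ N := norm_snd_le q
  have hx1 : |∑ i, P.partialX φ i i x q.1| ≤ |C₁| * (1 + N ^ P.p) := by
    calc _ ≤ ∑ i, |P.partialX φ i i x q.1| := Finset.abs_sum_le_sum_abs _ _
      _ ≤ C₁ * (1 + ‖q.1‖ ^ P.p) :=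
        (le_add_of_nonneg_left (Finset.sum_nonneg fun _ _ => abs_nonneg _)).trans (hC₁ x hx q.1)
      _ ≤ |C₁| * (1 + ‖q.1‖ ^ P.p) := by gcongr; exact le_abs_self _
      _ ≤ _ := by gcongr
  have hy1 : |∑ i, ∑ j, P.partialY φ i j x q.1 * matEntry q.2 j i| ≤
      2 * |C₂| * (1 + N ^ P.p) := by
    calc _ ≤ ∑ i, ∑ j, |P.partialY φ i j x q.1| * N := by
          refine (Finset.abs_sum_le_sum_abs _ _).trans (Finset.sum_le_sum fun i _ =>
            (Finset.abs_sum_le_sum_abs _ _).trans (Finset.sum_le_sum fun j _ => ?_))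
          rw [abs_mul]
          gcongr
          exact (abs_matEntry_le _ _ _).trans hz
      _ = (∑ i, ∑ j, |P.partialY φ i j x q.1|) * N := by simp only [Finset.sum_mul]
      _ ≤ C₂ * (1 + ‖q.1‖ ^ (P.p - 1)) * N := by gcongr; exact hC₂ x hx q.1
      _ ≤ |C₂| * (1 + N ^ (P.p - 1)) * N := by
          have : 0 ≤ P.p - 1 := by linarith
          gcongr
          exact le_abs_self _
      _ = |C₂| * (N + N ^ P.p) := by
          -- `N ^ (p - 1) * N = N ^ p` is obtained by dividing by `N`, so `N = 0` is separate; there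
          -- `p ≠ 0` is needed.
          rcases hN0.eq_or_lt with h | h
          · rw [← h]
            simp [Real.zero_rpow (show P.p ≠ 0 by linarith)]
          · rw [Real.rpow_sub_one h.ne']
            field_simp
      _ ≤ |C₂| * (2 * (1 + N ^ P.p)) := by
          gcongr
          rcases le_total N 1 with h | h
          · have : 0 ≤ N ^ P.p := by positivity
            linarith
          · have := Real.self_le_rpow_of_one_le h hp.le
            linarith
      _ = _ := by ring
  calc _ ≤ _ := abs_add_le _ _
    _ ≤ _ := add_le_add hx1 hy1
    _ = _ := by ring

/-- Each component of `outwardNormal` is at most `1` in absolute value, also where it takes its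
default value `0`. -/
theorem MemΦ.abs_inner_normal_le (hφ : P.MemΦ φ) : ∃ C : ℝ, ∀ x ∈ closure P.Ω, ∀ y : Euc m,
    |⟪φ (x, y), outwardNormal P.Ω x⟫| ≤ C * (1 + ‖y‖ ^ P.p) := by
  obtain ⟨C, hC⟩ := hφ.growth_x
  refine ⟨C, fun x hx y => ?_⟩
  have h1 : |⟪φ (x, y), outwardNormal P.Ω x⟫| ≤ ∑ i, |φ (x, y) i| := by
    rw [PiLp.inner_apply]
    refine (Finset.abs_sum_le_sum_abs _ _).trans (Finset.sum_le_sum fun i _ => ?_)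
    have h2 : |outwardNormal P.Ω x i| ≤ 1 :=
      (PiLp.norm_apply_le (outwardNormal P.Ω x) i).trans norm_outwardNormal_le
    simp only [RCLike.inner_apply, conj_trivial, abs_mul]
    exact mul_le_of_le_one_left (abs_nonneg _) h2
  exact h1.trans ((le_add_of_nonneg_right (Finset.sum_nonneg fun _ _ => abs_nonneg _)).trans
    (hC x hx y))

end Field

end VariationalProblem


theorem ContinuousOn.aestronglyMeasurable_surfaceMeasure {n : ℕ} {Ω : Set (Euc n)} {Y Z : Type*}
    [TopologicalSpace Y] [MeasurableSpace Y] [BorelSpace Y] [SecondCountableTopology Y]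
    [TopologicalSpace.PseudoMetrizableSpace Y]
    [TopologicalSpace Z] [TopologicalSpace.PseudoMetrizableSpace Z] [SecondCountableTopology Z]
    [MeasurableSpace Z] [BorelSpace Z] [Zero Z] {q : Euc n × Y → Z}
    (hq : ContinuousOn q (frontier Ω ×ˢ univ)) {v : Euc n → Y}
    (hv : AEStronglyMeasurable v (surfaceMeasure Ω)) :
    AEStronglyMeasurable (fun x => q (x, v x)) (surfaceMeasure Ω) :=
  ContinuousOn.aestronglyMeasurable_comp_prodMk isClosed_frontier.measurableSet hq hv

/-! ### Divergence theorem for Sobolev maps, integrability and the duality gap. -/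

namespace VariationalProblem

variable {n m : ℕ} (P : VariationalProblem n m)

theorem isFiniteMeasure_restrict : IsFiniteMeasure (volume.restrict P.Ω) :=
  ⟨by simpa using P.lipschitz.isBounded.measure_lt_top⟩

theorem _root_.IsSobolev.memLp_prodMk {Ω : Set (Euc n)} {p : ℝ} {u : Euc n → Euc m}
    {Du : Euc n → Grad n m} (hu : IsSobolev Ω p u Du) :
    MemLp (fun x => (u x, Du x)) (ENNReal.ofReal p) (volume.restrict Ω) :=
  MemLp.of_fst_snd ⟨hu.memLp, hu.memLp_grad⟩

variable {P} {φ : Euc n × Euc m → Euc n} {u w : Euc n → Euc m} {Du : Euc n → Grad n m}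

theorem MemΦ.aestronglyMeasurable_inner_normal (hφ : P.MemΦ φ) {v : Euc n → Euc m}
    (hv : AEStronglyMeasurable v (surfaceMeasure P.Ω)) :
    AEStronglyMeasurable (fun x => ⟪φ (x, v x), outwardNormal P.Ω x⟫) (surfaceMeasure P.Ω) :=
  ((hφ.contDiffOn.continuousOn.mono
    (prod_mono frontier_subset_closure subset_rfl)).aestronglyMeasurable_surfaceMeasure hv).inner
    P.lipschitz.aemeasurable_outwardNormal.aestronglyMeasurable

/-- The divergence theorem for the composition of a field with a Sobolev map. -/
theorem MemΦ.integral_totalDiv (hφ : P.MemΦ φ) (hu : IsSobolev P.Ω P.p u Du)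
    (hw : IsTrace P.Ω P.p u Du w) :
    ∫ x in P.Ω, P.totalDiv φ x (u x) (Du x) =
      ∫ x, ⟪φ (x, w x), outwardNormal P.Ω x⟫ ∂surfaceMeasure P.Ω := by
  have := P.isFiniteMeasure_restrict
  have := P.lipschitz.isFiniteMeasure_surfaceMeasure
  have hp := P.one_lt_p
  have hΩm := P.lipschitz.isOpen.measurableSet
  obtain ⟨hwLp, s, hs, hsu, hsDu, hsw⟩ := hw
  have hsc : ∀ k, Continuous (s k) := fun k => (hs k).continuous
  have hsdc : ∀ k, Continuous (fderiv ℝ (s k)) := fun k => (hs k).continuous_fderiv (by simp)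
  obtain ⟨C₁, hC₁⟩ := hφ.totalDiv_growth
  obtain ⟨C₂, hC₂⟩ := hφ.abs_inner_normal_le
  -- One sequence of smooth maps approximates `u`, `Du` and the trace `w` simultaneously. The
  -- identity for smooth maps passes to the limit on both sides.
  have lim1 : Tendsto (fun k => ∫ x in P.Ω, P.totalDiv φ x (s k x) (fderiv ℝ (s k) x)) atTop
      (𝓝 (∫ x in P.Ω, P.totalDiv φ x (u x) (Du x))) := by
    refine tendsto_integral_of_growth (q := fun x (q : Euc m × Grad n m) =>
      P.totalDiv φ x q.1 q.2) (p := P.p) (C := C₁) (v := fun x => (u x, Du x))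
      (w := fun k x => (s k x, fderiv ℝ (s k) x)) (by linarith) ?_ ?_ (fun v hv => ?_)
      (hu.memLp_prodMk) (fun k => ?_) ?_
    · filter_upwards [ae_restrict_mem hΩm] with x hx
      exact hφ.continuousOn_totalDiv.comp_continuous
        (f := fun q : Euc m × Grad n m => (x, q)) (by fun_prop) fun q => ⟨hx, mem_univ _⟩
    · filter_upwards [ae_restrict_mem hΩm] with x hx using hC₁ x (subset_closure hx)
    · exact hφ.continuousOn_totalDiv.aestronglyMeasurable_comp_prodMk hΩm hv
    · exact ((hsc k).prodMk (hsdc k)).aestronglyMeasurable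
    · exact tendsto_eLpNorm_prodMk_sub (by simpa using hp.le) hu.memLp.aestronglyMeasurable
        hu.memLp_grad.aestronglyMeasurable (fun k => (hsc k).aestronglyMeasurable)
        (fun k => (hsdc k).aestronglyMeasurable) hsu hsDu
  have lim2 : Tendsto (fun k => ∫ x, ⟪φ (x, s k x), outwardNormal P.Ω x⟫ ∂surfaceMeasure P.Ω) atTop
      (𝓝 (∫ x, ⟪φ (x, w x), outwardNormal P.Ω x⟫ ∂surfaceMeasure P.Ω)) := by
    have hmem : ∀ᵐ x ∂surfaceMeasure P.Ω, x ∈ closure P.Ω := by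
      filter_upwards [P.lipschitz.ae_mem_regularBoundary] with x hx
        using frontier_subset_closure hx.1
    refine tendsto_integral_of_growth (q := fun x y => ⟪φ (x, y), outwardNormal P.Ω x⟫)
      (p := P.p) (C := C₂) (by linarith) ?_ ?_ (fun v hv => hφ.aestronglyMeasurable_inner_normal hv)
      hwLp (fun k => (hsc k).aestronglyMeasurable) hsw
    · filter_upwards [hmem] with x hx
      exact (hφ.contDiffOn.continuousOn.comp_continuous (f := fun y : Euc m => (x, y))
        (by fun_prop) fun y => ⟨hx, mem_univ _⟩).inner continuous_const
    · filter_upwards [hmem] with x hx using hC₂ x hx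
  simp only [hφ.integral_totalDiv_of_contDiff (hs _)] at lim1
  exact tendsto_nhds_unique lim1 lim2

theorem integrableOn_bulk {f : Euc n → Euc m → Grad n m → ℝ}
    (hf : ContinuousOn (fun q : Euc n × Euc m × Grad n m => f q.1 q.2.1 q.2.2) (P.Ω ×ˢ univ))
    (hfC : ∃ C : ℝ, ∀ᵐ x ∂(volume.restrict P.Ω), ∀ y z,
      |f x y z| ≤ C * (1 + ‖y‖ ^ P.p + ‖z‖ ^ P.p)) (hu : IsSobolev P.Ω P.p u Du) :
    IntegrableOn (fun x => f x (u x) (Du x)) P.Ω := by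
  have := P.isFiniteMeasure_restrict
  have hp := P.one_lt_p
  obtain ⟨C, hC⟩ := hfC
  have hv : MemLp (fun x => (u x, Du x)) (ENNReal.ofReal P.p) (volume.restrict P.Ω) :=
    hu.memLp_prodMk
  refine integrable_of_growth (C := 2 * |C|) (by linarith) (hf.aestronglyMeasurable_comp_prodMk
    P.lipschitz.isOpen.measurableSet hv.aestronglyMeasurable) hv ?_
  filter_upwards [hC] with x hx
  have h1 : ‖u x‖ ^ P.p ≤ ‖(u x, Du x)‖ ^ P.p :=
    Real.rpow_le_rpow (norm_nonneg _) (norm_fst_le (u x, Du x)) (by linarith)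
  have h2 : ‖Du x‖ ^ P.p ≤ ‖(u x, Du x)‖ ^ P.p :=
    Real.rpow_le_rpow (norm_nonneg _) (norm_snd_le (u x, Du x)) (by linarith)
  have h3 : 0 ≤ ‖u x‖ ^ P.p := by positivity
  have h4 : 0 ≤ ‖Du x‖ ^ P.p := by positivity
  calc _ ≤ C * (1 + ‖u x‖ ^ P.p + ‖Du x‖ ^ P.p) := hx _ _
    _ ≤ |C| * (1 + ‖u x‖ ^ P.p + ‖Du x‖ ^ P.p) := by gcongr; exact le_abs_self C
    _ ≤ |C| * (2 * (1 + ‖(u x, Du x)‖ ^ P.p)) := by gcongr; linarith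
    _ = _ := by ring

theorem integrable_boundary {g : Euc n → Euc m → ℝ}
    (hg : ContinuousOn (fun q : Euc n × Euc m => g q.1 q.2) (frontier P.Ω ×ˢ univ))
    (hgC : ∃ C : ℝ, ∀ᵐ x ∂(surfaceMeasure P.Ω), ∀ y, |g x y| ≤ C * (1 + ‖y‖ ^ P.p))
    (hw : MemLp w (ENNReal.ofReal P.p) (surfaceMeasure P.Ω)) :
    Integrable (fun x => g x (w x)) (surfaceMeasure P.Ω) := by
  have := P.lipschitz.isFiniteMeasure_surfaceMeasure
  obtain ⟨C, hC⟩ := hgC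
  refine integrable_of_growth (C := C) (by linarith [P.one_lt_p])
    (hg.aestronglyMeasurable_surfaceMeasure hw.aestronglyMeasurable) hw ?_
  filter_upwards [hC] with x hx using hx _

theorem MemΦ.integrableOn_totalDiv (hφ : P.MemΦ φ) (hu : IsSobolev P.Ω P.p u Du) :
    IntegrableOn (fun x => P.totalDiv φ x (u x) (Du x)) P.Ω := by
  have := P.isFiniteMeasure_restrict
  have hΩm := P.lipschitz.isOpen.measurableSet
  obtain ⟨C, hC⟩ := hφ.totalDiv_growth
  have hv : MemLp (fun x => (u x, Du x)) (ENNReal.ofReal P.p) (volume.restrict P.Ω) :=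
    hu.memLp_prodMk
  have hm := hφ.continuousOn_totalDiv.aestronglyMeasurable_comp_prodMk hΩm hv.aestronglyMeasurable
  dsimp only at hm
  have hg : ∀ᵐ x ∂volume.restrict P.Ω,
      |P.totalDiv φ x (u x) (Du x)| ≤ C * (1 + ‖(u x, Du x)‖ ^ P.p) := by
    filter_upwards [ae_restrict_mem hΩm] with x hx
    exact hC x (subset_closure hx) (u x, Du x)
  exact integrable_of_growth (by linarith [P.one_lt_p]) hm hv hg

theorem MemΦ.integrable_inner_normal (hφ : P.MemΦ φ)
    (hw : MemLp w (ENNReal.ofReal P.p) (surfaceMeasure P.Ω)) :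
    Integrable (fun x => ⟪φ (x, w x), outwardNormal P.Ω x⟫) (surfaceMeasure P.Ω) := by
  have := P.lipschitz.isFiniteMeasure_surfaceMeasure
  obtain ⟨C, hC⟩ := hφ.abs_inner_normal_le
  refine integrable_of_growth (C := C) (by linarith [P.one_lt_p])
    (hφ.aestronglyMeasurable_inner_normal hw.aestronglyMeasurable) hw ?_
  filter_upwards [P.lipschitz.ae_mem_regularBoundary] with x hx
    using hC x (frontier_subset_closure hx.1) (w x)

variable {η : ℝ} {h l : Euc n → ℝ}

theorem MemB.integrableOn_h (hB : P.MemB φ η h l) : IntegrableOn h P.Ω :=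
  (hB.h_cont.integrableOn_compact P.lipschitz.isCompact_closure).mono_set subset_closure

theorem MemB.integrable_l (hB : P.MemB φ η h l) : Integrable l (surfaceMeasure P.Ω) := by
  have := P.lipschitz.isFiniteMeasure_surfaceMeasure
  have h1 : IntegrableOn l (frontier P.Ω) (surfaceMeasure P.Ω) :=
    hB.l_cont.integrableOn_compact P.lipschitz.isCompact_frontier
  rwa [IntegrableOn, IsLipschitzDomain.surfaceMeasure_restrict_frontier] at h1

theorem MemB.integrableOn_bigF (hB : P.MemB φ η h l) (hu : IsSobolev P.Ω P.p u Du) :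
    IntegrableOn (fun x => P.bigF φ η h x (u x) (Du x)) P.Ω :=
  (((integrableOn_bulk P.f_cont P.f_growth hu).add (hB.memΦ.integrableOn_totalDiv hu)).sub
    ((integrableOn_bulk P.a_cont P.a_growth hu).const_mul η)).sub hB.integrableOn_h

theorem MemB.integrable_bigG (hB : P.MemB φ η h l)
    (hw : MemLp w (ENNReal.ofReal P.p) (surfaceMeasure P.Ω)) :
    Integrable (fun x => P.bigG φ η l x (w x)) (surfaceMeasure P.Ω) :=
  (((integrable_boundary P.g_cont P.g_growth hw).sub (hB.memΦ.integrable_inner_normal hw)).sub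
    ((integrable_boundary P.b_cont P.b_growth hw).const_mul η)).sub hB.integrable_l

/-- The duality gap is the sum of the integrals of `F` and `G`. -/
theorem MemB.integral_bigF_add_integral_bigG (hB : P.MemB φ η h l) (hu : P.Admissible u Du w) :
    (∫ x in P.Ω, P.bigF φ η h x (u x) (Du x)) +
      ∫ x, P.bigG φ η l x (w x) ∂surfaceMeasure P.Ω = P.Ψ u Du w - P.dualObjective h l := by
  have hS := hu.isSobolev
  have hw := hu.isTrace.1
  have hf := integrableOn_bulk P.f_cont P.f_growth hS
  have ha := (integrableOn_bulk P.a_cont P.a_growth hS).const_mul η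
  have hD := hB.memΦ.integrableOn_totalDiv hS
  have hg := integrable_boundary P.g_cont P.g_growth hw
  have hb := (integrable_boundary P.b_cont P.b_growth hw).const_mul η
  have hN := hB.memΦ.integrable_inner_normal hw
  have hF : ∫ x in P.Ω, P.bigF φ η h x (u x) (Du x) =
      (∫ x in P.Ω, P.f x (u x) (Du x)) + (∫ x in P.Ω, P.totalDiv φ x (u x) (Du x)) -
        η * (∫ x in P.Ω, P.a x (u x) (Du x)) - ∫ x in P.Ω, h x := by
    have hfD : Integrable (fun x => P.f x (u x) (Du x) + P.totalDiv φ x (u x) (Du x))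
      (volume.restrict P.Ω) := hf.add hD
    simp only [bigF]
    rw [integral_sub (by exact hfD.sub ha) hB.integrableOn_h, integral_sub hfD ha,
      integral_add hf hD, integral_const_mul]
  have hG : ∫ x, P.bigG φ η l x (w x) ∂surfaceMeasure P.Ω =
      (∫ x, P.g x (w x) ∂surfaceMeasure P.Ω) -
        (∫ x, ⟪φ (x, w x), outwardNormal P.Ω x⟫ ∂surfaceMeasure P.Ω) -
        η * (∫ x, P.b x (w x) ∂surfaceMeasure P.Ω) - ∫ x, l x ∂surfaceMeasure P.Ω := by
    have hgN : Integrable (fun x => P.g x (w x) - ⟪φ (x, w x), outwardNormal P.Ω x⟫)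
      (surfaceMeasure P.Ω) := hg.sub hN
    simp only [bigG]
    rw [integral_sub (by exact hgN.sub hb) hB.integrable_l, integral_sub hgN hb,
      integral_sub hg hN, integral_const_mul]
  rw [hF, hG, hB.memΦ.integral_totalDiv hS hu.isTrace, Ψ, dualObjective]
  -- The boundary flux of `φ` has already cancelled its bulk integral; what is left is `-η` times
  -- the integral constraint.
  linear_combination (-η) * hu.integral_constraint

theorem MemB.ae_bigF_nonneg (hB : P.MemB φ η h l) (hu : P.Admissible u Du w) :
    ∀ᵐ x ∂volume.restrict P.Ω, 0 ≤ P.bigF φ η h x (u x) (Du x) := by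
  filter_upwards [ae_restrict_mem P.lipschitz.isOpen.measurableSet, hu.bulk_constraint] with x hx hc
  exact hB.F_nonneg (x, u x, Du x) ⟨subset_closure hx, hc⟩

/-- Dual feasibility gives `G ≥ 0` only where the normal exists, which is almost everywhere on the
boundary of a Lipschitz domain. -/
theorem MemB.ae_bigG_nonneg (hB : P.MemB φ η h l) (hu : P.Admissible u Du w) :
    ∀ᵐ x ∂surfaceMeasure P.Ω, 0 ≤ P.bigG φ η l x (w x) := by
  filter_upwards [P.lipschitz.ae_mem_regularBoundary, hu.boundary_constraint] with x hx hd
  exact hB.G_nonneg (x, w x) ⟨hx.1, hd⟩ hx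

end VariationalProblem

/-! ### Markov's inequality and the conclusion. -/

/-- The optimal value is an extended real. The bounds by real numbers exclude both infinities, and
the rest is real arithmetic. -/
theorem EReal.sub_le_of_le_add_of_sub_le {v : EReal} {a b ε : ℝ}
    (h₁ : (a : EReal) ≤ v + (ε : EReal)) (h₂ : v - (ε : EReal) ≤ (b : EReal)) :
    a - b ≤ 2 * ε := by
  induction v with
  | bot => simp at h₁
  | top => simp at h₂
  | coe v =>
    have h₁' : a ≤ v + ε := by exact_mod_cast h₁
    have h₂' : v - ε ≤ b := by exact_mod_cast h₂
    linarith

theorem MeasureTheory.measure_ge_le_ofReal_integral_div {X : Type*} [MeasurableSpace X]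
    {μ : Measure X} [IsFiniteMeasure μ] {f : X → ℝ} (hf : Integrable f μ) (hf0 : 0 ≤ᵐ[μ] f)
    {δ : ℝ} (hδ : 0 < δ) : μ {x | δ ≤ f x} ≤ ENNReal.ofReal ((∫ x, f x ∂μ) / δ) := by
  rw [← ofReal_measureReal]
  apply ENNReal.ofReal_le_ofReal
  rw [le_div_iff₀ hδ, mul_comm]
  exact mul_meas_ge_le_integral_of_nonneg hf0 hf δ

theorem mainTheorem8 {n m : ℕ} (P : VariationalProblem n m)
    (hsharp : P.optimalValue = P.dualValue)
    (ε : ℝ) (hε : 0 < ε)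
    (u : Euc n → Euc m) (Du : Euc n → Grad n m) (w : Euc n → Euc m)
    (hu : P.Admissible u Du w)
    (hu_opt : ((P.Ψ u Du w : ℝ) : EReal) ≤ P.optimalValue + ((ε : ℝ) : EReal))
    (φ : Euc n × Euc m → Euc n) (η : ℝ) (h l : Euc n → ℝ)
    (hB : P.MemB φ η h l)
    (hB_opt : P.optimalValue - ((ε : ℝ) : EReal) ≤ ((P.dualObjective h l : ℝ) : EReal))
    (δ : ℝ) (hδ : 0 < δ) :
    volume {x | x ∈ P.Ω ∧ δ ≤ P.bigF φ η h x (u x) (Du x)} +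
      surfaceMeasure P.Ω {x | x ∈ frontier P.Ω ∧ δ ≤ P.bigG φ η l x (w x)} ≤
        ENNReal.ofReal (2 * ε / δ) := by
  have := P.isFiniteMeasure_restrict
  have := P.lipschitz.isFiniteMeasure_surfaceMeasure
  have hF0 := hB.ae_bigF_nonneg hu
  have hG0 := hB.ae_bigG_nonneg hu
  have hF := measure_ge_le_ofReal_integral_div (hB.integrableOn_bigF hu.isSobolev) hF0 hδ
  have hG := measure_ge_le_ofReal_integral_div (hB.integrable_bigG hu.isTrace.1) hG0 hδ
  -- This form needs measurability of `Ω` only; the superlevel set of `F` along `u` is not known to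
  -- be measurable.
  rw [Measure.restrict_apply' P.lipschitz.isOpen.measurableSet] at hF
  calc _ ≤ ENNReal.ofReal ((∫ x in P.Ω, P.bigF φ η h x (u x) (Du x)) / δ) +
        ENNReal.ofReal ((∫ x, P.bigG φ η l x (w x) ∂surfaceMeasure P.Ω) / δ) :=
        add_le_add ((measure_mono (by exact fun x hx => ⟨hx.2, hx.1⟩)).trans hF)
          ((measure_mono (by exact fun x hx => hx.2)).trans hG)
    _ = ENNReal.ofReal ((P.Ψ u Du w - P.dualObjective h l) / δ) := by
        rw [← ENNReal.ofReal_add (div_nonneg (integral_nonneg_of_ae hF0) hδ.le)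
          (div_nonneg (integral_nonneg_of_ae hG0) hδ.le), ← add_div,
          hB.integral_bigF_add_integral_bigG hu]
    _ ≤ _ := by
        apply ENNReal.ofReal_le_ofReal
        gcongr
        exact EReal.sub_le_of_le_add_of_sub_le hu_opt hB_opt
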